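/- Let $(M,\omega)$ be a complete Hermitian manifold of complex dimension $n$, with fundamental form $\omega=\sqrt{-1}\,h_{i\bar j}\,dz^i\wedge d\bar z^j$, and suppose that $\omega$ is Gauduchon, i.e. $\partial\bar\partial\omega^{n-1}=0$. For $t\in\mathbb R$ let ${}^t\nabla=(1-t)\,{}^C\nabla+t\,{}^B\nabla$ be the Gauduchon connection, where ${}^C\nabla$ is the Chern connection (the Hermitian connection compatible with the holomorphic structure) and ${}^B\nabla$ is the Bismut connection (the Hermitian connection with totally skew-symmetric torsion). Let $R(X,Y,Z,W)=g\big({}^t\nabla_X{}^t\nabla_YZ-{}^t\nabla_Y{}^t\nabla_XZ-{}^t\nabla_{[X,Y]}Z,W\big)$ be its ($\mathbb C$-multilinearly extended) curvature tensor, where $g$ is the underlying Riemannian metric with $g(\partial_i,\partial_{\bar j})=h_{i\bar j}$, and let $$S^{(1)}(\omega,t)=h^{i\bar j}h^{k\bar l}R_{i\bar jk\bar l},\qquad S^{(2)}(\omega,t)=h^{i\bar l}h^{k\bar j}R_{i\bar jk\bar l}$$ be its first and second scalar curvatures. Suppose that $S^{(1)}(\omega,t)$ and $S^{(2)}(\omega,t)$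 are integrable with respect to $\omega^n/n!$ and that $$-\infty<\int_M S^{(1)}(\omega,t)\,\frac{\omega^n}{n!}\le\int_M S^{(2)}(\omega,t)\,\frac{\omega^n}{n!}<+\infty .$$ Then: 1. If $n\ge3$ and $t=0$, then $\omega$ is balanced (i.e. $d\omega^{n-1}=0$) and $S^{(1)}(\omega,t)=S^{(2)}(\omega,t)$ on $M$. 2. If $n\ge3$, $t\ne0$ and $\omega$ is balanced, then $\omega$ is Kähler (i.e. $d\omega=0$). 3. If $n\ge2$ and $t\in(-\infty,0)\cup(0,2-\sqrt3]\cup[2+\sqrt3,+\infty)$, then $\omega$ is Kähler. 4. If $n=2$ and $t\in(-\infty,\tfrac13)\cup(1,+\infty)$, then $\omega$ is Kähler. -/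

import Mathlib

open scoped Manifold ContDiff Topology ENNReal ComplexConjugate
open MeasureTheory

noncomputable section

namespace HermGeom

/-! ### Calculus on open sets of `ℂⁿ` -/

/-- The coordinate space `ℂⁿ`. -/
abbrev Cn (n : ℕ) : Type := Fin n → ℂ

variable {n : ℕ}

/-- `∂f/∂zⁱ = (∂f/∂xⁱ - √-1 ∂f/∂yⁱ) / 2`. -/
def dz (i : Fin n) (f : Cn n → ℂ) (z : Cn n) : ℂ :=
  (fderiv ℝ f z (Pi.single i 1) - Complex.I * fderiv ℝ f z (Pi.single i Complex.I)) / 2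

/-- `∂f/∂z̄ⁱ = (∂f/∂xⁱ + √-1 ∂f/∂yⁱ) / 2`. -/
def dzbar (i : Fin n) (f : Cn n → ℂ) (z : Cn n) : ℂ :=
  (fderiv ℝ f z (Pi.single i 1) + Complex.I * fderiv ℝ f z (Pi.single i Complex.I)) / 2

/-- A `(p,q)`-form on a domain of `ℂⁿ`, given by its components: `α` stands for
`(1 / (p! q!)) ∑ α_{i₁…i_p j̄₁…j̄_q} dz^{i₁} ∧ … ∧ dz^{i_p} ∧ dz̄^{j₁} ∧ … ∧ dz̄^{j_q}`,
with components skew-symmetric in the `i`'s and in the `j`'s. -/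
abbrev PQForm (n p q : ℕ) : Type := Cn n → (Fin p → Fin n) → (Fin q → Fin n) → ℂ

/-- The exterior product of a `(p,q)`-form and a `(p',q')`-form; the sign `(-1)^{q p'}` comes from
moving the `dz`'s of the second factor past the `dz̄`'s of the first one. -/
def PQForm.wedge {p q p' q' : ℕ} (α : PQForm n p q) (β : PQForm n p' q') :
    PQForm n (p + p') (q + q') := fun z a b =>
  ((-1 : ℂ) ^ (q * p') /
      ((p.factorial : ℂ) * (q.factorial : ℂ) * (p'.factorial : ℂ) * (q'.factorial : ℂ))) *
    ∑ σ : Equiv.Perm (Fin (p + p')), ∑ τ : Equiv.Perm (Fin (q + q')),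
      ((Equiv.Perm.sign σ : ℤ) : ℂ) * ((Equiv.Perm.sign τ : ℤ) : ℂ) *
        (α z (fun s => a (σ (Fin.castAdd p' s))) (fun s => b (τ (Fin.castAdd q' s))) *
          β z (fun s => a (σ (Fin.natAdd p s))) (fun s => b (τ (Fin.natAdd q s))))

/-- The operator `∂ : Ω^{p,q} → Ω^{p+1,q}`. -/
def PQForm.del {p q : ℕ} (α : PQForm n p q) : PQForm n (p + 1) q := fun z a b =>
  ∑ s : Fin (p + 1), (-1 : ℂ) ^ (s : ℕ) * dz (a s) (fun w => α w (s.removeNth a) b) z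

/-- The operator `∂̄ : Ω^{p,q} → Ω^{p,q+1}`. -/
def PQForm.delbar {p q : ℕ} (α : PQForm n p q) : PQForm n p (q + 1) := fun z a b =>
  (-1 : ℂ) ^ p *
    ∑ s : Fin (q + 1), (-1 : ℂ) ^ (s : ℕ) * dzbar (b s) (fun w => α w a (s.removeNth b)) z

/-- `dα = ∂α + ∂̄α` vanishes at `z`, i.e. both of its components (which have the different
types `(p+1,q)` and `(p,q+1)`) vanish at `z`. -/
def PQForm.IsClosedAt {p q : ℕ} (α : PQForm n p q) (z : Cn n) : Prop :=
  (∀ a b, α.del z a b = 0) ∧ (∀ a b, α.delbar z a b = 0)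

/-! ### Local Hermitian geometry

Below `H z k l = h_{k l̄}(z)` is the coefficient matrix of a Hermitian metric on a domain of `ℂⁿ`;
the inverse coefficients are `h^{l q̄} = (H z)⁻¹ q l`, so that `∑_q h_{k q̄} h^{l q̄} = δ_k^l`. -/

/-- The fundamental form `√-1 h_{i j̄} dzⁱ ∧ dz̄ʲ`. -/
def fundForm (H : Cn n → Matrix (Fin n) (Fin n) ℂ) : PQForm n 1 1 := fun z a b =>
  Complex.I * H z (a 0) (b 0)

/-- The exterior powers `ωᵏ` of the fundamental form. -/
def fundFormPow (H : Cn n → Matrix (Fin n) (Fin n) ℂ) : (k : ℕ) → PQForm n k k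
  | 0 => fun _ _ _ => 1
  | k + 1 => (fundFormPow H k).wedge (fundForm H)

/-- Labels of the coordinate frame of the complexified tangent bundle:
`Sum.inl i` is `∂/∂zⁱ` and `Sum.inr i` is `∂/∂z̄ⁱ`. -/
abbrev Ix (n : ℕ) : Type := Fin n ⊕ Fin n

/-- Complex conjugation of the frame. -/
def Ix.bar (A : Ix n) : Ix n := A.swap

/-- Differentiation of a function along a vector field of the coordinate frame. -/
def frameDeriv : Ix n → (Cn n → ℂ) → Cn n → ℂ
  | Sum.inl i => dz i
  | Sum.inr i => dzbar i

/-- The `ℂ`-bilinear extension of the Riemannian metric `g` in the coordinate frame: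
`g(∂_i, ∂_j̄) = h_{i j̄}`, `g(∂_i, ∂_j) = g(∂_ī, ∂_j̄) = 0`. -/
def gC (H : Cn n → Matrix (Fin n) (Fin n) ℂ) (z : Cn n) : Ix n → Ix n → ℂ
  | Sum.inl i, Sum.inr j => H z i j
  | Sum.inr j, Sum.inl i => H z i j
  | Sum.inl _, Sum.inl _ => 0
  | Sum.inr _, Sum.inr _ => 0

/-- Connection coefficients on the complexified tangent bundle of a domain of `ℂⁿ`:
`∇_{∂_A} ∂_B = ∑_C Γ z A B C ∂_C`. -/
abbrev Conn (n : ℕ) : Type := Cn n → Ix n → Ix n → Ix n → ℂ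

/-- `Γ` comes (at `z`) from a real connection with `∇J = 0` and `∇g = 0`. -/
structure IsHermitianConn (H : Cn n → Matrix (Fin n) (Fin n) ℂ) (Γ : Conn n) (z : Cn n) :
    Prop where
  real : ∀ A B C, Γ z A.bar B.bar C.bar = conj (Γ z A B C)
  parallel_J : ∀ A i j, Γ z A (Sum.inl i) (Sum.inr j) = 0
  metric : ∀ A B C, frameDeriv A (fun w => gC H w B C) z =
    ∑ D, Γ z A B D * gC H z D C + ∑ D, Γ z A C D * gC H z B D

/-- The torsion `g(∇_{∂_A} ∂_B - ∇_{∂_B} ∂_A - [∂_A, ∂_B], ∂_C)`. -/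
def torsion (H : Cn n → Matrix (Fin n) (Fin n) ℂ) (Γ : Conn n) (z : Cn n) (A B C : Ix n) : ℂ :=
  ∑ D, (Γ z A B D - Γ z B A D) * gC H z D C

/-- The Chern connection coefficients `Γ_{ik}^l = h^{l q̄} ∂_i h_{k q̄}`. -/
def chernCoeff (H : Cn n → Matrix (Fin n) (Fin n) ℂ) (z : Cn n) (i k l : Fin n) : ℂ :=
  ∑ q, dz i (fun w => H w k q) z * (H z)⁻¹ q l

/-- The Chern connection, see `isChern_iff`. -/
def chernConn (H : Cn n → Matrix (Fin n) (Fin n) ℂ) : Conn n := fun z A B C =>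
  match A, B, C with
  | Sum.inl i, Sum.inl k, Sum.inl l => chernCoeff H z i k l
  | Sum.inr i, Sum.inr k, Sum.inr l => conj (chernCoeff H z i k l)
  | _, _, _ => 0

/-- The torsion `T_{ij}^k = h^{k l̄} (∂_i h_{j l̄} - ∂_j h_{i l̄})` of the Chern connection. -/
def chernTorsion (H : Cn n → Matrix (Fin n) (Fin n) ℂ) (z : Cn n) (i j k : Fin n) : ℂ :=
  chernCoeff H z i j k - chernCoeff H z j i k

/-- `h^{l q̄} h_{k r̄} \overline{T_{jq}^r}`. -/
def bismutMixed (H : Cn n → Matrix (Fin n) (Fin n) ℂ) (z : Cn n) (j k l : Fin n) : ℂ :=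
  ∑ q, ∑ r, (H z)⁻¹ q l * H z k r * conj (chernTorsion H z j q r)

/-- The Bismut connection, see `isBismut_iff`. -/
def bismutConn (H : Cn n → Matrix (Fin n) (Fin n) ℂ) : Conn n := fun z A B C =>
  match A, B, C with
  | Sum.inl i, Sum.inl k, Sum.inl l => chernCoeff H z k i l
  | Sum.inr i, Sum.inr k, Sum.inr l => conj (chernCoeff H z k i l)
  | Sum.inr j, Sum.inl k, Sum.inl l => bismutMixed H z j k l
  | Sum.inl j, Sum.inr k, Sum.inr l => conj (bismutMixed H z j k l)
  | _, _, _ => 0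

theorem dzbar_conj (i : Fin n) (f : Cn n → ℂ) (z : Cn n) :
    dzbar i (fun w => conj (f w)) z = conj (dz i f z) := by
  have h : fderiv ℝ (fun w => conj (f w)) z =
      (Complex.conjCLE : ℂ →L[ℝ] ℂ).comp (fderiv ℝ f z) :=
    Complex.conjCLE.comp_fderiv (f := f) (x := z)
  have h2 : (starRingEnd ℂ) (2 : ℂ) = 2 := Complex.conj_ofNat 2
  simp [dzbar, dz, h, h2]

theorem frameDeriv_zero (A : Ix n) (z : Cn n) : frameDeriv A (fun _ => (0 : ℂ)) z = 0 := by
  cases A <;> simp [frameDeriv, dz, dzbar]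

section Spec

variable {H : Cn n → Matrix (Fin n) (Fin n) ℂ} {Γ : Conn n} {z : Cn n}

theorem chernCoeff_lower (hdet : IsUnit (H z).det) (i k q : Fin n) :
    ∑ l, chernCoeff H z i k l * H z l q = dz i (fun w => H w k q) z := by
  have h : Matrix.vecMul (Matrix.vecMul (fun p => dz i (fun w => H w k p) z) (H z)⁻¹) (H z)
      = fun p => dz i (fun w => H w k p) z := by
    rw [Matrix.vecMul_vecMul, Matrix.nonsing_inv_mul _ hdet, Matrix.vecMul_one]
  exact congrFun h q

theorem lower_injective (hdet : IsUnit (H z).det) {a b : Fin n → ℂ}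
    (h : ∀ q, ∑ l, a l * H z l q = ∑ l, b l * H z l q) : a = b := by
  have h' : Matrix.vecMul a (H z) = Matrix.vecMul b (H z) := funext h
  have := congrArg (fun v => Matrix.vecMul v (H z)⁻¹) h'
  simpa [Matrix.vecMul_vecMul, Matrix.mul_nonsing_inv _ hdet] using this

theorem conj_H (hH : ∀ w, (H w).IsHermitian) (w : Cn n) (k l : Fin n) :
    conj (H w k l) = H w l k := (hH w).apply l k

theorem dzbar_H (hH : ∀ w, (H w).IsHermitian) (i k l : Fin n) :
    dzbar i (fun w => H w k l) z = conj (dz i (fun w => H w l k) z) := by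
  rw [← dzbar_conj]
  simp only [conj_H hH]

/-- The conditions on a Hermitian connection, in terms of its coefficients `Γ_{ik}^l` and
`Γ_{j̄k}^l`. -/
theorem isHermitianConn_iff (hH : ∀ w, (H w).IsHermitian) :
    IsHermitianConn H Γ z ↔
      (∀ A B C, Γ z A.bar B.bar C.bar = conj (Γ z A B C)) ∧
      (∀ A i j, Γ z A (Sum.inl i) (Sum.inr j) = 0) ∧
      ∀ i k q, dz i (fun w => H w k q) z =
        ∑ l, Γ z (Sum.inl i) (Sum.inl k) (Sum.inl l) * H z l q +
          ∑ r, conj (Γ z (Sum.inr i) (Sum.inl q) (Sum.inl r)) * H z k r := by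
  constructor
  · rintro ⟨hr, hJ, hm⟩
    refine ⟨hr, hJ, fun i k q => ?_⟩
    have := hm (Sum.inl i) (Sum.inl k) (Sum.inr q)
    simp only [frameDeriv, gC, Fintype.sum_sum_type, mul_zero, Finset.sum_const_zero, add_zero,
      zero_add] at this
    rw [this]
    congr 1
    exact Finset.sum_congr rfl fun r _ => by rw [← hr]; rfl
  · rintro ⟨hr, hJ, hm⟩
    have hJ' : ∀ A i j, Γ z A (Sum.inr i) (Sum.inl j) = 0 := fun A i j => by
      have := hr A.bar (Sum.inl i) (Sum.inr j)
      rw [hJ, map_zero] at this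
      simpa [Ix.bar] using this
    have h1 : ∀ i q r, Γ z (Sum.inl i) (Sum.inr q) (Sum.inr r) =
        conj (Γ z (Sum.inr i) (Sum.inl q) (Sum.inl r)) := fun i q r => hr (Sum.inr i) (Sum.inl q) (Sum.inl r)
    have h2 : ∀ i q r, Γ z (Sum.inr i) (Sum.inr q) (Sum.inr r) =
        conj (Γ z (Sum.inl i) (Sum.inl q) (Sum.inl r)) := fun i q r => hr (Sum.inl i) (Sum.inl q) (Sum.inl r)
    refine ⟨hr, hJ, ?_⟩
    rintro (i | i) (k | k) (q | q)
    all_goals simp only [gC, Fintype.sum_sum_type, mul_zero, Finset.sum_const_zero, add_zero,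
      zero_add, hJ, hJ', zero_mul, frameDeriv_zero]
    · simp only [frameDeriv, hm, h1]
    · simp only [frameDeriv, hm, h1]
      rw [add_comm]
    · simp only [frameDeriv, dzbar_H hH, hm, map_add, map_sum, map_mul, conj_H hH,
        Complex.conj_conj, h2]
      rw [add_comm]
    · simp only [frameDeriv, dzbar_H hH, hm, map_add, map_sum, map_mul, conj_H hH,
        Complex.conj_conj, h2]

/-- The Chern connection is the unique Hermitian connection compatible with the holomorphic
structure, i.e. with `∇_{∂_j̄} ∂_k = 0`. -/
theorem isChern_iff (hH : ∀ w, (H w).IsHermitian) (hdet : IsUnit (H z).det) :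
    (IsHermitianConn H Γ z ∧ ∀ j k l, Γ z (Sum.inr j) (Sum.inl k) (Sum.inl l) = 0) ↔
      Γ z = chernConn H z := by
  rw [isHermitianConn_iff hH]
  constructor
  · rintro ⟨⟨hr, hJ, hm⟩, h0⟩
    have ha : ∀ i k l, Γ z (Sum.inl i) (Sum.inl k) (Sum.inl l) = chernCoeff H z i k l := by
      intro i k
      refine congrFun (lower_injective hdet fun q => ?_)
      rw [chernCoeff_lower hdet, hm]
      simp [h0]
    funext A B C
    rcases A with i | i <;> rcases B with k | k <;> rcases C with l | l
    · exact ha i k l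
    · exact hJ _ _ _
    · exact (hr (Sum.inr i) (Sum.inl k) (Sum.inr l)).trans (by simp [hJ, chernConn])
    · exact (hr (Sum.inr i) (Sum.inl k) (Sum.inl l)).trans (by simp [h0, chernConn])
    · exact h0 _ _ _
    · exact hJ _ _ _
    · exact (hr (Sum.inl i) (Sum.inl k) (Sum.inr l)).trans (by simp [hJ, chernConn])
    · exact (hr (Sum.inl i) (Sum.inl k) (Sum.inl l)).trans (by simp [ha, chernConn])
  · intro h
    rw [h]
    refine ⟨⟨?_, ?_, ?_⟩, ?_⟩
    · rintro (i | i) (k | k) (l | l) <;> simp [chernConn, Ix.bar]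
    · rintro (i | i) k l <;> rfl
    · intro i k q
      simp [chernConn, chernCoeff_lower hdet]
    · intros; rfl

theorem bismutMixed_lower (hdet : IsUnit (H z).det) (j k q : Fin n) :
    ∑ l, bismutMixed H z j k l * H z l q = ∑ r, H z k r * conj (chernTorsion H z j q r) := by
  have h : Matrix.vecMul (Matrix.vecMul
      (fun p => ∑ r, H z k r * conj (chernTorsion H z j p r)) (H z)⁻¹) (H z)
      = fun p => ∑ r, H z k r * conj (chernTorsion H z j p r) := by
    rw [Matrix.vecMul_vecMul, Matrix.nonsing_inv_mul _ hdet, Matrix.vecMul_one]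
  rw [← congrFun h q]
  refine Finset.sum_congr rfl fun l _ => ?_
  congr 1
  simp only [bismutMixed, Matrix.vecMul, dotProduct, Finset.sum_mul]
  exact Finset.sum_congr rfl fun p _ => Finset.sum_congr rfl fun r _ => by ring

/-- `h_{k r̄} \overline{T_{jq}^r} = ∂_j̄ h_{k q̄} - ∂_q̄ h_{k j̄}`. -/
theorem bismutMixed_lower' (hH : ∀ w, (H w).IsHermitian) (hdet : IsUnit (H z).det)
    (j k q : Fin n) :
    ∑ l, bismutMixed H z j k l * H z l q =
      conj (dz j (fun w => H w q k) z - dz q (fun w => H w j k) z) := by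
  rw [bismutMixed_lower hdet, ← chernCoeff_lower hdet, ← chernCoeff_lower hdet,
    ← Finset.sum_sub_distrib, map_sum]
  refine Finset.sum_congr rfl fun r _ => ?_
  simp only [chernTorsion, map_sub, map_mul, conj_H hH]
  ring

/-- The Bismut connection is the unique Hermitian connection with totally skew-symmetric
torsion. -/
theorem isBismut_iff (hH : ∀ w, (H w).IsHermitian) (hdet : IsUnit (H z).det) :
    (IsHermitianConn H Γ z ∧ ∀ A B C, torsion H Γ z A B C = -torsion H Γ z A C B) ↔
      Γ z = bismutConn H z := by
  rw [isHermitianConn_iff hH]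
  constructor
  · rintro ⟨⟨hr, hJ, hm⟩, ht⟩
    have hJ' : ∀ A i j, Γ z A (Sum.inr i) (Sum.inl j) = 0 := fun A i j => by
      have := hr A.bar (Sum.inl i) (Sum.inr j)
      rw [hJ, map_zero] at this
      simpa [Ix.bar] using this
    have h1 : ∀ i q r, Γ z (Sum.inl i) (Sum.inr q) (Sum.inr r) =
        conj (Γ z (Sum.inr i) (Sum.inl q) (Sum.inl r)) := fun i q r => hr (Sum.inr i) (Sum.inl q) (Sum.inl r)
    have ha : ∀ i k l, Γ z (Sum.inl i) (Sum.inl k) (Sum.inl l) = chernCoeff H z k i l := by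
      intro i k
      refine congrFun (lower_injective hdet fun q => ?_)
      rw [chernCoeff_lower hdet, hm k i q]
      have := ht (Sum.inl k) (Sum.inl i) (Sum.inr q)
      simp only [torsion, gC, Fintype.sum_sum_type, mul_zero, Finset.sum_const_zero, add_zero,
        zero_add, hJ, hJ', sub_zero, zero_mul, h1, sub_mul, Finset.sum_sub_distrib] at this
      linear_combination -this
    have hb : ∀ j k l, Γ z (Sum.inr j) (Sum.inl k) (Sum.inl l) = bismutMixed H z j k l := by
      intro j k
      refine congrFun (lower_injective hdet fun q => ?_)
      rw [bismutMixed_lower' hH hdet, hm j q k]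
      simp only [ha, chernCoeff_lower hdet, map_sub, map_add, map_sum, map_mul, conj_H hH,
        Complex.conj_conj]
      ring
    funext A B C
    rcases A with i | i <;> rcases B with k | k <;> rcases C with l | l
    · exact ha i k l
    · exact hJ _ _ _
    · exact hJ' _ _ _
    · exact (hr (Sum.inr i) (Sum.inl k) (Sum.inl l)).trans (by simp [hb, bismutConn])
    · exact hb _ _ _
    · exact hJ _ _ _
    · exact hJ' _ _ _
    · exact (hr (Sum.inl i) (Sum.inl k) (Sum.inl l)).trans (by simp [ha, bismutConn])
  · intro h
    have hcl : ∀ i k q, ∑ l, conj (chernCoeff H z i k l) * H z q l =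
        conj (dz i (fun w => H w k q) z) := fun i k q => by
      rw [← chernCoeff_lower hdet, map_sum]
      simp only [map_mul, conj_H hH]
    have hbl : ∀ j k q, ∑ l, conj (bismutMixed H z j k l) * H z q l =
        dz j (fun w => H w q k) z - dz q (fun w => H w j k) z := fun j k q => by
      rw [← Complex.conj_conj (_ - _), ← bismutMixed_lower' hH hdet, map_sum]
      simp only [map_mul, conj_H hH]
    refine ⟨⟨?_, ?_, ?_⟩, ?_⟩
    · rw [h]
      rintro (i | i) (k | k) (l | l) <;> simp [bismutConn, Ix.bar]
    · rw [h]
      rintro (i | i) k l <;> rfl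
    · intro i k q
      simp only [h, bismutConn, chernCoeff_lower hdet, hbl]
      ring
    · rintro (i | i) (k | k) (q | q) <;>
      simp only [torsion, h, bismutConn, gC, Fintype.sum_sum_type, mul_zero,
        Finset.sum_const_zero, add_zero, zero_add, sub_zero, zero_sub, sub_self, zero_mul,
        sub_mul, Finset.sum_sub_distrib, chernCoeff_lower hdet,
        bismutMixed_lower' hH hdet, hcl, hbl, map_sub, neg_zero, neg_neg] <;> ring

end Spec

/-- The Gauduchon connection `∇^t = (1 - t) ∇^Chern + t ∇^Bismut`. -/
def gauduchonConn (H : Cn n → Matrix (Fin n) (Fin n) ℂ) (t : ℝ) : Conn n := fun z A B C =>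
  (1 - (t : ℂ)) * chernConn H z A B C + (t : ℂ) * bismutConn H z A B C

/-- The curvature tensor `R(∂_A, ∂_B, ∂_C, ∂_D) =
g(∇_A ∇_B ∂_C - ∇_B ∇_A ∂_C - ∇_{[∂_A, ∂_B]} ∂_C, ∂_D)`. -/
def curvature (H : Cn n → Matrix (Fin n) (Fin n) ℂ) (Γ : Conn n) (z : Cn n) (A B C D : Ix n) :
    ℂ :=
  ∑ E, (frameDeriv A (fun w => Γ w B C E) z - frameDeriv B (fun w => Γ w A C E) z +
    ∑ F, (Γ z B C F * Γ z A F E - Γ z A C F * Γ z B F E)) * gC H z E D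

/-- The first scalar curvature `h^{i j̄} h^{k l̄} R_{i j̄ k l̄}`. -/
def localScalar1 (H : Cn n → Matrix (Fin n) (Fin n) ℂ) (t : ℝ) (z : Cn n) : ℂ :=
  ∑ i, ∑ j, ∑ k, ∑ l, (H z)⁻¹ j i * (H z)⁻¹ l k *
    curvature H (gauduchonConn H t) z (Sum.inl i) (Sum.inr j) (Sum.inl k) (Sum.inr l)

/-- The second scalar curvature `h^{i l̄} h^{k j̄} R_{i j̄ k l̄}`. -/
def localScalar2 (H : Cn n → Matrix (Fin n) (Fin n) ℂ) (t : ℝ) (z : Cn n) : ℂ :=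
  ∑ i, ∑ j, ∑ k, ∑ l, (H z)⁻¹ l i * (H z)⁻¹ j k *
    curvature H (gauduchonConn H t) z (Sum.inl i) (Sum.inr j) (Sum.inl k) (Sum.inr l)

/-! ### Hermitian manifolds -/

variable {M : Type*} [TopologicalSpace M] [ChartedSpace (Cn n) M]

/-- The coordinate vector `∂/∂zⁱ` of the chart `e` at the point with coordinate `z`. -/
def coordVec (e : OpenPartialHomeomorph M (Cn n)) (z : Cn n) (i : Fin n) :
    TangentSpace 𝓘(ℂ, Cn n) (e.symm z) :=
  mfderiv 𝓘(ℂ, Cn n) 𝓘(ℂ, Cn n) e.symm z (Pi.single i (1 : ℂ) : Cn n)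

variable (n M) in
/-- A smooth Hermitian metric on a complex manifold. The complex vector space `T_x M` is identified
with `T^{1,0}_x M` by `X ↦ (X - √-1 J X) / 2`, and `inner x u v` is `h(u, v̄)`. -/
structure HermitianMetric where
  inner : ∀ x : M, TangentSpace 𝓘(ℂ, Cn n) x →ₗ[ℂ] TangentSpace 𝓘(ℂ, Cn n) x →ₗ⋆[ℂ] ℂ
  conj_symm : ∀ x u v, inner x u v = conj (inner x v u)
  pos : ∀ x u, u ≠ 0 → 0 < (inner x u u).re
  smooth : ∀ e ∈ atlas (Cn n) M, ∀ i j, ContDiffOn ℝ ∞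
    (fun z => inner (e.symm z) (coordVec e z i) (coordVec e z j)) e.target

namespace HermitianMetric

/-- The coefficients `h_{i j̄} = h(∂/∂zⁱ, ∂/∂z̄ʲ)` in the chart `e`. -/
def coeff (h : HermitianMetric n M) (e : OpenPartialHomeomorph M (Cn n)) (z : Cn n) :
    Matrix (Fin n) (Fin n) ℂ :=
  Matrix.of fun i j => h.inner (e.symm z) (coordVec e z i) (coordVec e z j)

/-- `dω = 0`. -/
def IsKahler (h : HermitianMetric n M) : Prop :=
  ∀ e ∈ atlas (Cn n) M, ∀ z ∈ e.target, (fundForm (h.coeff e)).IsClosedAt z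

/-- `dω^{n-1} = 0`. -/
def IsBalanced (h : HermitianMetric n M) : Prop :=
  ∀ e ∈ atlas (Cn n) M, ∀ z ∈ e.target, (fundFormPow (h.coeff e) (n - 1)).IsClosedAt z

/-- `∂∂̄ω^{n-1} = 0`. -/
def IsGauduchon (h : HermitianMetric n M) : Prop :=
  ∀ e ∈ atlas (Cn n) M, ∀ z ∈ e.target, ∀ a b,
    (fundFormPow (h.coeff e) (n - 1)).delbar.del z a b = 0

/-- The first scalar curvature `S^{(1)}(ω, t)` of the Gauduchon connection `∇^t`; the contraction
does not depend on the coordinates, and the preferred chart at `x` is used to compute it. -/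
def scalar1 (h : HermitianMetric n M) (t : ℝ) (x : M) : ℂ :=
  localScalar1 (h.coeff (chartAt (Cn n) x)) t (chartAt (Cn n) x x)

/-- The second scalar curvature `S^{(2)}(ω, t)` of the Gauduchon connection `∇^t`; the contraction
does not depend on the coordinates, and the preferred chart at `x` is used to compute it. -/
def scalar2 (h : HermitianMetric n M) (t : ℝ) (x : M) : ℂ :=
  localScalar2 (h.coeff (chartAt (Cn n) x)) t (chartAt (Cn n) x x)

/-- The restriction of `ωⁿ / n!` to the domain of the chart `e`. In coordinates `z = x + √-1 y` it
is `det(h_{i j̄}) ∏ (√-1 dzⁱ ∧ dz̄ⁱ) = 2ⁿ det(h_{i j̄}) dx¹ dy¹ … dxⁿ dyⁿ`. -/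
def chartVolume [MeasurableSpace M] (h : HermitianMetric n M)
    (e : OpenPartialHomeomorph M (Cn n)) : Measure M :=
  ((volume.restrict e.target).withDensity
    (fun z => ENNReal.ofReal (2 ^ n * (h.coeff e z).det.re))).map e.symm

/-- The Riemannian volume measure `ωⁿ / n!`. The measures given by the single charts agree on
overlaps, so their supremum is the measure on `M` whose restriction to each chart domain is the
one given by that chart. -/
def volume [MeasurableSpace M] (h : HermitianMetric n M) : Measure M :=
  ⨆ e ∈ atlas (Cn n) M, h.chartVolume e

/-- The length of a real tangent vector: a real vector is `X = u + ū` with `u` of type `(1,0)`, and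
`g(X, X) = 2 h(u, ū)`. -/
def length (h : HermitianMetric n M) (x : M) (u : TangentSpace 𝓘(ℂ, Cn n) x) : ℝ :=
  Real.sqrt (2 * (h.inner x u u).re)

/-- The Riemannian distance of `g`: the infimum of the lengths of `C¹` paths (infinite between
different components). -/
def edist (h : HermitianMetric n M) (x y : M) : ℝ≥0∞ :=
  letI : ∀ p : M, ENorm (TangentSpace 𝓘(ℝ, Cn n) p) :=
    fun p => ⟨fun u => ENNReal.ofReal (h.length p u)⟩
  Manifold.riemannianEDist 𝓘(ℝ, Cn n) x y

/-- Completeness of `(M, g)`: every Cauchy sequence of the Riemannian distance converges. -/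
def IsComplete (h : HermitianMetric n M) : Prop :=
  ∀ u : ℕ → M, (∀ ε : ℝ≥0∞, 0 < ε → ∃ N, ∀ k ≥ N, ∀ l ≥ N, h.edist (u k) (u l) < ε) →
    ∃ x, Filter.Tendsto u Filter.atTop (𝓝 x)

end HermitianMetric

end HermGeom

end

noncomputable section

namespace HermGeom

open scoped ComplexOrder

variable {n : ℕ}

/-! ### Calculus of the frame derivatives -/

section Calculus

variable {A : Ix n} {f g : Cn n → ℂ} {z : Cn n}

/-! Everything rests on a pointwise identity. Let `T` be the Chern torsion, `τ_i = T_{ik}^k` its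
trace, and `|T|²` the full sum over both lower indices. For a Gauduchon metric, `S⁽¹⁾ - S⁽²⁾ = (t² -
4t + 1)|τ|² + t²|T|²` (`localScalar1_sub_localScalar2`).

The Gauduchon condition enters through linear algebra. The components of `ω^{n-1}` are, up to one
constant, the `(n-1)`-minors of `h`, so `∂ω^{n-1}` amounts to the column divergence `∂_k adj(h)_{qk}
= det h · h^{k q̄} τ_k`. Hence balanced means `τ = 0`, and Gauduchon means `∂_s (det h · V^s) = 0`
for `V^s = h^{s q̄} \overline{τ_q}`. Expanding the latter gives `h^{i j̄} ∂_j̄ τ_i = -|τ|²`, which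
removes every derivative of the torsion from the traced curvatures. The second derivatives of `h`
left in the two scalar curvatures differ only by one more such contraction.

In each of the four cases the right-hand side has nonnegative real part: `t² - 4t + 1 ≥ 0` outside
`(2 - √3, 2 + √3)`; for `n = 2` one has `|T|² = 2|τ|²`, so the total coefficient is `3t² - 4t + 1 =
(3t - 1)(t - 1)`; for balanced metrics only `t²|T|²` remains; for `t = 0` only `|τ|²` remains. The
integral inequality then forces the right-hand side to vanish almost everywhere
(`ae_sub_re_eq_zero`), and with it `T` or `τ`.

The pointwise quantities are computed in a chart that varies with the point, so they are not visibly
continuous. Tensoriality of `T` and `τ` under holomorphic coordinate changes moves the almost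
everywhere vanishing into one fixed chart, where smoothness upgrades it to vanishing everywhere
(`chernTorsion_eq_zero_of_ae`, `torsionTrace_eq_zero_of_ae`). -/

theorem differentiableAt_prod {ι : Type*} (s : Finset ι) {f : ι → Cn n → ℂ}
    (hf : ∀ i ∈ s, DifferentiableAt ℝ (f i) z) :
    DifferentiableAt ℝ (fun w => ∏ i ∈ s, f i w) z := by
  classical
  exact (HasFDerivAt.finsetProd fun i hi => (hf i hi).hasFDerivAt).differentiableAt

theorem frameDeriv_congr (h : f =ᶠ[𝓝 z] g) : frameDeriv A f z = frameDeriv A g z := by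
  rcases A with i | i <;> simp only [frameDeriv, dz, dzbar, h.fderiv_eq]

theorem frameDeriv_const (c : ℂ) : frameDeriv A (fun _ => c) z = 0 := by
  rcases A with i | i <;> simp [frameDeriv, dz, dzbar]

theorem frameDeriv_add (hf : DifferentiableAt ℝ f z) (hg : DifferentiableAt ℝ g z) :
    frameDeriv A (fun w => f w + g w) z = frameDeriv A f z + frameDeriv A g z := by
  rcases A with i | i <;> simp only [frameDeriv, dz, dzbar, fderiv_fun_add hf hg,
    add_apply] <;> ring

theorem frameDeriv_mul (hf : DifferentiableAt ℝ f z) (hg : DifferentiableAt ℝ g z) :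
    frameDeriv A (fun w => f w * g w) z = frameDeriv A f z * g z + f z * frameDeriv A g z := by
  rcases A with i | i <;> simp only [frameDeriv, dz, dzbar, fderiv_fun_mul hf hg,
    add_apply, smul_apply, smul_eq_mul] <;> ring

theorem frameDeriv_const_mul (c : ℂ) (hf : DifferentiableAt ℝ f z) :
    frameDeriv A (fun w => c * f w) z = c * frameDeriv A f z := by
  rw [frameDeriv_mul (differentiableAt_const c) hf, frameDeriv_const]
  ring

theorem frameDeriv_neg (hf : DifferentiableAt ℝ f z) :
    frameDeriv A (fun w => -f w) z = -frameDeriv A f z := by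
  have := frameDeriv_const_mul (A := A) (-1) hf
  simpa using this

theorem frameDeriv_sub (hf : DifferentiableAt ℝ f z) (hg : DifferentiableAt ℝ g z) :
    frameDeriv A (fun w => f w - g w) z = frameDeriv A f z - frameDeriv A g z := by
  have := frameDeriv_add (A := A) hf hg.fun_neg
  rw [frameDeriv_neg hg] at this
  simpa only [sub_eq_add_neg] using this

theorem frameDeriv_sum {ι : Type*} (s : Finset ι) {f : ι → Cn n → ℂ}
    (hf : ∀ i ∈ s, DifferentiableAt ℝ (f i) z) :
    frameDeriv A (fun w => ∑ i ∈ s, f i w) z = ∑ i ∈ s, frameDeriv A (f i) z := by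
  classical
  induction s using Finset.induction_on with
  | empty => simpa using frameDeriv_const 0
  | insert a s ha ih =>
    have hs : ∀ i ∈ s, DifferentiableAt ℝ (f i) z := fun i hi => hf i (Finset.mem_insert_of_mem hi)
    simp only [Finset.sum_insert ha]
    rw [frameDeriv_add (hf a (Finset.mem_insert_self a s)) (DifferentiableAt.fun_sum hs), ih hs]

theorem frameDeriv_prod {ι : Type*} [DecidableEq ι] (s : Finset ι) {f : ι → Cn n → ℂ}
    (hf : ∀ i ∈ s, DifferentiableAt ℝ (f i) z) :
    frameDeriv A (fun w => ∏ i ∈ s, f i w) z =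
      ∑ i ∈ s, (∏ j ∈ s.erase i, f j z) * frameDeriv A (f i) z := by
  induction s using Finset.induction_on with
  | empty => simpa using frameDeriv_const 1
  | insert a s ha ih =>
    have hs : ∀ i ∈ s, DifferentiableAt ℝ (f i) z := fun i hi => hf i (Finset.mem_insert_of_mem hi)
    simp only [Finset.prod_insert ha]
    rw [frameDeriv_mul (hf a (Finset.mem_insert_self a s)) (differentiableAt_prod s hs),
      ih hs, Finset.sum_insert ha, Finset.erase_insert ha, Finset.mul_sum]
    congr 1
    · ring
    · refine Finset.sum_congr rfl fun i hi => ?_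
      have hia : a ≠ i := fun h => ha (h ▸ hi)
      rw [Finset.erase_insert_of_ne hia, Finset.prod_insert (fun h => ha (Finset.mem_of_mem_erase h))]
      ring

theorem frameDeriv_conj : frameDeriv A (fun w => conj (f w)) z = conj (frameDeriv A.bar f z) := by
  rcases A with i | i
  · have := dzbar_conj i (fun w => conj (f w)) z
    simp only [Complex.conj_conj] at this
    simp only [frameDeriv, Ix.bar, Sum.swap_inl, this, Complex.conj_conj]
  · exact dzbar_conj i f z

theorem contDiffOn_frameDeriv {U : Set (Cn n)} (hU : IsOpen U) (hf : ContDiffOn ℝ ∞ f U) :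
    ContDiffOn ℝ ∞ (frameDeriv A f) U := by
  have h : ∀ v : Cn n, ContDiffOn ℝ ∞ (fun w => fderiv ℝ f w v) U := fun v =>
    (hf.fderiv_of_isOpen hU (m := ∞) le_rfl).clm_apply contDiffOn_const
  rcases A with i | i
  · exact ((h _).sub (contDiffOn_const.mul (h _))).div_const 2
  · exact ((h _).add (contDiffOn_const.mul (h _))).div_const 2

theorem contDiffOn_conj {U : Set (Cn n)} (hf : ContDiffOn ℝ ∞ f U) :
    ContDiffOn ℝ ∞ (fun w => conj (f w)) U :=
  Complex.conjCLE.contDiff.comp_contDiffOn hf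

theorem contDiffOn_det {k : ℕ} {U : Set (Cn n)} {H : Cn n → Matrix (Fin k) (Fin k) ℂ}
    (hH : ∀ i j, ContDiffOn ℝ ∞ (fun w => H w i j) U) :
    ContDiffOn ℝ ∞ (fun w => (H w).det) U := by
  simp only [Matrix.det_apply']
  exact ContDiffOn.sum fun σ _ => contDiffOn_const.mul (contDiffOn_prod fun i _ => hH _ _)

theorem contDiffOn_adjugate {k : ℕ} {U : Set (Cn n)} {H : Cn n → Matrix (Fin k) (Fin k) ℂ}
    (hH : ∀ i j, ContDiffOn ℝ ∞ (fun w => H w i j) U) (i j : Fin k) :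
    ContDiffOn ℝ ∞ (fun w => (H w).adjugate i j) U := by
  simp only [Matrix.adjugate_apply]
  refine contDiffOn_det fun l r => ?_
  by_cases hl : l = j
  · subst hl
    simpa using contDiffOn_const
  · simpa [Matrix.updateRow_ne hl] using hH l r

theorem differentiableAt_of_contDiffOn {U : Set (Cn n)} (hU : IsOpen U) (hz : z ∈ U)
    (hf : ContDiffOn ℝ ∞ f U) : DifferentiableAt ℝ f z :=
  (hf.contDiffAt (hU.mem_nhds hz)).differentiableAt (by simp)

/-- Jacobi's formula. Differentiating one column at a time leaves determinants with one column
replaced, and Cramer's rule writes these through the adjugate. -/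
theorem frameDeriv_det {k : ℕ} {H : Cn n → Matrix (Fin k) (Fin k) ℂ}
    (hH : ∀ i j, DifferentiableAt ℝ (fun w => H w i j) z) :
    frameDeriv A (fun w => (H w).det) z =
      ∑ i, ∑ j, (H z).adjugate i j * frameDeriv A (fun w => H w j i) z := by
  have h1 : ∀ i, ∑ j, (H z).adjugate i j * frameDeriv A (fun w => H w j i) z =
      ((H z).updateCol i fun j => frameDeriv A (fun w => H w j i) z).det := fun i => by
    rw [← Matrix.cramer_apply, Matrix.cramer_eq_adjugate_mulVec]
    rfl
  simp only [h1, Matrix.det_apply']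
  have hd : ∀ σ : Equiv.Perm (Fin k), DifferentiableAt ℝ (fun w => ∏ i, H w (σ i) i) z :=
    fun σ => differentiableAt_prod _ fun i _ => hH _ _
  rw [frameDeriv_sum (f := fun (σ : Equiv.Perm (Fin k)) w =>
    ((Equiv.Perm.sign σ : ℤ) : ℂ) * ∏ i, H w (σ i) i) _
    fun σ _ => (differentiableAt_const _).mul (hd σ), Finset.sum_comm]
  refine Finset.sum_congr rfl fun σ _ => ?_
  rw [frameDeriv_const_mul _ (hd σ), frameDeriv_prod (f := fun i w => H w (σ i) i) _
    fun i _ => hH _ _, Finset.mul_sum]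
  refine Finset.sum_congr rfl fun i _ => ?_
  congr 1
  rw [← Finset.mul_prod_erase Finset.univ _ (Finset.mem_univ i), mul_comm]
  congr 1
  · simp
  · refine Finset.prod_congr rfl fun j hj => ?_
    rw [Matrix.updateCol_ne (Finset.ne_of_mem_erase hj)]

end Calculus

/-! ### Hermitian metrics on open sets of `ℂⁿ` -/


/-- The matrix of the derivatives of the entries. -/
def frameDerivMat (A : Ix n) (F : Cn n → Matrix (Fin n) (Fin n) ℂ) (z : Cn n) :
    Matrix (Fin n) (Fin n) ℂ :=
  Matrix.of fun i j => frameDeriv A (fun w => F w i j) z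

/-- `H` is the coefficient matrix of a smooth Hermitian metric on the open set `U`. -/
structure IsLocalMetric (U : Set (Cn n)) (H : Cn n → Matrix (Fin n) (Fin n) ℂ) : Prop where
  isOpen : IsOpen U
  herm : ∀ w, (H w).IsHermitian
  pos : ∀ w ∈ U, (H w).PosDef
  smooth : ∀ i j, ContDiffOn ℝ ∞ (fun w => H w i j) U

/-- The trace `τ_i = T_{ik}^k` of the torsion of the Chern connection. -/
def torsionTrace (H : Cn n → Matrix (Fin n) (Fin n) ℂ) (z : Cn n) (i : Fin n) : ℂ :=
  ∑ k, chernTorsion H z i k k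

/-- `h^{i j̄} τ_i \overline{τ_j}`. -/
def torsionTraceNormSq (H : Cn n → Matrix (Fin n) (Fin n) ℂ) (z : Cn n) : ℂ :=
  ∑ i, ∑ j, (H z)⁻¹ j i * torsionTrace H z i * conj (torsionTrace H z j)

/-- `h^{i q̄} h^{k j̄} h_{f r̄} T_{ik}^f \overline{T_{qj}^r}`. -/
def torsionNormSq (H : Cn n → Matrix (Fin n) (Fin n) ℂ) (z : Cn n) : ℂ :=
  ∑ i, ∑ q, ∑ k, ∑ j, ∑ f, ∑ r, (H z)⁻¹ q i * (H z)⁻¹ j k * H z f r *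
    (chernTorsion H z i k f * conj (chernTorsion H z q j r))

theorem frameDerivMat_mul {A : Ix n} {F K : Cn n → Matrix (Fin n) (Fin n) ℂ} {z : Cn n}
    (hF : ∀ i j, DifferentiableAt ℝ (fun w => F w i j) z)
    (hK : ∀ i j, DifferentiableAt ℝ (fun w => K w i j) z) :
    frameDerivMat A (fun w => F w * K w) z =
      frameDerivMat A F z * K z + F z * frameDerivMat A K z := by
  ext i j
  simp only [frameDerivMat, Matrix.of_apply, Matrix.mul_apply, Matrix.add_apply]
  rw [frameDeriv_sum (f := fun k w => F w i k * K w k j) _ fun k _ => (hF i k).mul (hK k j),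
    ← Finset.sum_add_distrib]
  exact Finset.sum_congr rfl fun k _ => frameDeriv_mul (hF i k) (hK k j)

namespace IsLocalMetric

variable {U : Set (Cn n)} {H : Cn n → Matrix (Fin n) (Fin n) ℂ} {z : Cn n}

theorem det_ne_zero (hH : IsLocalMetric U H) (hz : z ∈ U) : (H z).det ≠ 0 :=
  ((hH.pos z hz).det_pos).ne'

theorem isUnit_det (hH : IsLocalMetric U H) (hz : z ∈ U) : IsUnit (H z).det :=
  (hH.det_ne_zero hz).isUnit

theorem differentiableAt (hH : IsLocalMetric U H) (hz : z ∈ U) {f : Cn n → ℂ}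
    (hf : ContDiffOn ℝ ∞ f U) : DifferentiableAt ℝ f z :=
  differentiableAt_of_contDiffOn hH.isOpen hz hf

theorem eventually_mem (hH : IsLocalMetric U H) (hz : z ∈ U) : ∀ᶠ w in 𝓝 z, w ∈ U :=
  hH.isOpen.mem_nhds hz

theorem smooth_adjugate (hH : IsLocalMetric U H) (i j : Fin n) :
    ContDiffOn ℝ ∞ (fun w => (H w).adjugate i j) U :=
  contDiffOn_adjugate hH.smooth i j

theorem smooth_det (hH : IsLocalMetric U H) : ContDiffOn ℝ ∞ (fun w => (H w).det) U :=
  contDiffOn_det hH.smooth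

theorem smooth_inv (hH : IsLocalMetric U H) (i j : Fin n) :
    ContDiffOn ℝ ∞ (fun w => (H w)⁻¹ i j) U := by
  have h : ∀ w, (H w)⁻¹ i j = ((H w).det)⁻¹ * (H w).adjugate i j := fun w => by
    rw [Matrix.inv_def, Ring.inverse_eq_inv']
    rfl
  simp only [h]
  exact (hH.smooth_det.inv fun w hw => hH.det_ne_zero hw).mul (hH.smooth_adjugate i j)

theorem conj_inv (hH : IsLocalMetric U H) (w : Cn n) (i j : Fin n) :
    conj ((H w)⁻¹ i j) = (H w)⁻¹ j i := (hH.herm w).inv.apply j i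

theorem smooth_chernCoeff (hH : IsLocalMetric U H) (i k l : Fin n) :
    ContDiffOn ℝ ∞ (fun w => chernCoeff H w i k l) U :=
  ContDiffOn.sum fun q _ => (contDiffOn_frameDeriv (A := Sum.inl i) hH.isOpen (hH.smooth k q)).mul
    (hH.smooth_inv q l)

theorem smooth_chernTorsion (hH : IsLocalMetric U H) (i k l : Fin n) :
    ContDiffOn ℝ ∞ (fun w => chernTorsion H w i k l) U :=
  (hH.smooth_chernCoeff i k l).sub (hH.smooth_chernCoeff k i l)

theorem smooth_torsionTrace (hH : IsLocalMetric U H) (i : Fin n) :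
    ContDiffOn ℝ ∞ (fun w => torsionTrace H w i) U :=
  ContDiffOn.sum fun k _ => hH.smooth_chernTorsion i k k

theorem smooth_bismutMixed (hH : IsLocalMetric U H) (j k l : Fin n) :
    ContDiffOn ℝ ∞ (fun w => bismutMixed H w j k l) U :=
  ContDiffOn.sum fun q _ => ContDiffOn.sum fun r _ =>
    ((hH.smooth_inv q l).mul (hH.smooth k r)).mul (contDiffOn_conj (hH.smooth_chernTorsion j q r))

theorem sum_inv_mul (hH : IsLocalMetric U H) (hz : z ∈ U) (i j : Fin n) :
    ∑ k, (H z)⁻¹ i k * H z k j = if i = j then 1 else 0 := by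
  have := congrFun (congrFun (Matrix.nonsing_inv_mul _ (hH.isUnit_det hz)) i) j
  rwa [Matrix.mul_apply, Matrix.one_apply] at this

theorem sum_mul_inv (hH : IsLocalMetric U H) (hz : z ∈ U) (i j : Fin n) :
    ∑ k, H z i k * (H z)⁻¹ k j = if i = j then 1 else 0 := by
  have := congrFun (congrFun (Matrix.mul_nonsing_inv _ (hH.isUnit_det hz)) i) j
  rwa [Matrix.mul_apply, Matrix.one_apply] at this

/-- `∂_i h^{k j̄} = -h^{p j̄} Γ_{ip}^k`. -/
theorem dz_inv (hH : IsLocalMetric U H) (hz : z ∈ U) (i j k : Fin n) :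
    dz i (fun w => (H w)⁻¹ j k) z = -∑ p, (H z)⁻¹ j p * chernCoeff H z i p k := by
  have hd : ∀ i j, DifferentiableAt ℝ (fun w => H w i j) z := fun i j =>
    hH.differentiableAt hz (hH.smooth i j)
  have hdi : ∀ i j, DifferentiableAt ℝ (fun w => (H w)⁻¹ i j) z := fun i j =>
    hH.differentiableAt hz (hH.smooth_inv i j)
  -- The inverse is differentiated through `H H⁻¹ = 1`, which is known only on `U`, hence the
  -- eventual equality.
  have h1 : frameDerivMat (Sum.inl i) (fun w => H w * (H w)⁻¹) z = 0 := by
    ext a b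
    rw [frameDerivMat, Matrix.of_apply, frameDeriv_congr (g := fun _ => (1 : Matrix _ _ ℂ) a b),
      frameDeriv_const]
    · rfl
    · filter_upwards [hH.eventually_mem hz] with w hw
      rw [Matrix.mul_nonsing_inv _ (hH.isUnit_det hw)]
  rw [frameDerivMat_mul hd hdi] at h1
  have h2 := congrArg (fun X => (H z)⁻¹ * X) (eq_neg_of_add_eq_zero_right h1)
  simp only [← Matrix.mul_assoc, Matrix.nonsing_inv_mul _ (hH.isUnit_det hz), Matrix.one_mul] at h2
  have h3 := congrFun (congrFun h2 j) k
  rw [Matrix.mul_neg, Matrix.neg_apply, Matrix.mul_apply] at h3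
  exact h3

theorem adjugate_eq (hH : IsLocalMetric U H) (hz : z ∈ U) (a b : Fin n) :
    (H z).adjugate a b = (H z).det * (H z)⁻¹ a b := by
  rw [Matrix.inv_def, Matrix.smul_apply, smul_eq_mul, ← mul_assoc,
    Ring.mul_inverse_cancel _ (hH.isUnit_det hz), one_mul]

/-- `∂_i det h = Γ_{ik}^k det h`. -/
theorem dz_det (hH : IsLocalMetric U H) (hz : z ∈ U) (i : Fin n) :
    dz i (fun w => (H w).det) z = (H z).det * ∑ k, chernCoeff H z i k k := by
  have hd : ∀ i j, DifferentiableAt ℝ (fun w => H w i j) z := fun i j =>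
    hH.differentiableAt hz (hH.smooth i j)
  have h := frameDeriv_det (A := Sum.inl i) hd
  refine h.trans ?_
  rw [Finset.sum_comm, Finset.mul_sum]
  refine Finset.sum_congr rfl fun k _ => ?_
  rw [chernCoeff, Finset.mul_sum]
  refine Finset.sum_congr rfl fun q _ => ?_
  rw [hH.adjugate_eq hz]
  simp only [frameDeriv]
  ring

/-- With `adj h = det h · h⁻¹`, the determinant contributes `Γ_{kl}^l` and the inverse contributes
`-Γ_{kp}^k`; their combination is exactly the torsion trace. This is how `τ` appears in `∂ω^{n-1}`.
-/
theorem sum_dz_adjugate (hH : IsLocalMetric U H) (hz : z ∈ U) (q : Fin n) :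
    ∑ k, dz k (fun w => (H w).adjugate q k) z =
      (H z).det * ∑ k, (H z)⁻¹ q k * torsionTrace H z k := by
  have hdi : ∀ i j, DifferentiableAt ℝ (fun w => (H w)⁻¹ i j) z := fun i j =>
    hH.differentiableAt hz (hH.smooth_inv i j)
  have hdet : DifferentiableAt ℝ (fun w => (H w).det) z :=
    hH.differentiableAt hz hH.smooth_det
  have h1 : ∀ k, dz k (fun w => (H w).adjugate q k) z =
      (H z).det * ((H z)⁻¹ q k * (∑ l, chernCoeff H z k l l) -
        ∑ p, (H z)⁻¹ q p * chernCoeff H z k p k) := fun k => by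
    have h2 : dz k (fun w => (H w).adjugate q k) z =
        dz k (fun w => (H w).det * (H w)⁻¹ q k) z := by
      refine frameDeriv_congr (A := Sum.inl k) ?_
      filter_upwards [hH.eventually_mem hz] with w hw using hH.adjugate_eq hw q k
    have h3 := frameDeriv_mul (A := Sum.inl k) hdet (hdi q k)
    simp only [frameDeriv] at h3
    rw [h2, h3, hH.dz_det hz, hH.dz_inv hz]
    ring
  simp only [h1, ← Finset.mul_sum, torsionTrace, chernTorsion]
  congr 1
  simp only [Finset.sum_sub_distrib, mul_sub, Finset.mul_sum]
  congr 1
  exact Finset.sum_comm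

end IsLocalMetric

/-! ### The scalar curvatures of the Gauduchon connection -/

section Wirtinger

variable {f g : Cn n → ℂ} {z : Cn n}

theorem dz_mul (i : Fin n) (hf : DifferentiableAt ℝ f z) (hg : DifferentiableAt ℝ g z) :
    dz i (fun w => f w * g w) z = dz i f z * g z + f z * dz i g z :=
  frameDeriv_mul (A := Sum.inl i) hf hg

theorem dz_const_mul (i : Fin n) (c : ℂ) (hf : DifferentiableAt ℝ f z) :
    dz i (fun w => c * f w) z = c * dz i f z :=
  frameDeriv_const_mul (A := Sum.inl i) c hf

theorem dz_sum {ι : Type*} (i : Fin n) (s : Finset ι) {f : ι → Cn n → ℂ}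
    (hf : ∀ k ∈ s, DifferentiableAt ℝ (f k) z) :
    dz i (fun w => ∑ k ∈ s, f k w) z = ∑ k ∈ s, dz i (f k) z :=
  frameDeriv_sum (A := Sum.inl i) s hf

theorem dz_conj (i : Fin n) (f : Cn n → ℂ) (z : Cn n) :
    dz i (fun w => conj (f w)) z = conj (dzbar i f z) :=
  frameDeriv_conj (A := Sum.inl i)

theorem dz_congr (i : Fin n) (h : f =ᶠ[𝓝 z] g) : dz i f z = dz i g z :=
  frameDeriv_congr (A := Sum.inl i) h

theorem dzbar_sub (i : Fin n) (hf : DifferentiableAt ℝ f z) (hg : DifferentiableAt ℝ g z) :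
    dzbar i (fun w => f w - g w) z = dzbar i f z - dzbar i g z :=
  frameDeriv_sub (A := Sum.inr i) hf hg

theorem dzbar_const_mul (i : Fin n) (c : ℂ) (hf : DifferentiableAt ℝ f z) :
    dzbar i (fun w => c * f w) z = c * dzbar i f z :=
  frameDeriv_const_mul (A := Sum.inr i) c hf

theorem dzbar_sum {ι : Type*} (i : Fin n) (s : Finset ι) {f : ι → Cn n → ℂ}
    (hf : ∀ k ∈ s, DifferentiableAt ℝ (f k) z) :
    dzbar i (fun w => ∑ k ∈ s, f k w) z = ∑ k ∈ s, dzbar i (f k) z :=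
  frameDeriv_sum (A := Sum.inr i) s hf

end Wirtinger

/-- The coefficients `Γ_{ik}^e - t T_{ik}^e` of the Gauduchon connection. -/
def gauduchonCoeff (H : Cn n → Matrix (Fin n) (Fin n) ℂ) (t : ℝ) (z : Cn n) (i k e : Fin n) : ℂ :=
  chernCoeff H z i k e - t * chernTorsion H z i k e

/-- The coefficients `R_{i j̄ k}^e` of the curvature of the Gauduchon connection. -/
def mixedCurvature (H : Cn n → Matrix (Fin n) (Fin n) ℂ) (t : ℝ) (z : Cn n) (i j k e : Fin n) :
    ℂ :=
  t * dz i (fun w => bismutMixed H w j k e) z - dzbar j (fun w => chernCoeff H w i k e) z +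
    t * dzbar j (fun w => chernTorsion H w i k e) z +
    (t * ∑ f, bismutMixed H z j k f * gauduchonCoeff H t z i f e -
      t * ∑ f, gauduchonCoeff H t z i k f * bismutMixed H z j f e)

theorem gauduchonConn_inl (H : Cn n → Matrix (Fin n) (Fin n) ℂ) (t : ℝ) (i k e : Fin n)
    (w : Cn n) : gauduchonConn H t w (Sum.inl i) (Sum.inl k) (Sum.inl e) =
      gauduchonCoeff H t w i k e := by
  simp only [gauduchonConn, chernConn, bismutConn, gauduchonCoeff, chernTorsion]
  ring

theorem gauduchonConn_inr (H : Cn n → Matrix (Fin n) (Fin n) ℂ) (t : ℝ) (j k e : Fin n)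
    (w : Cn n) : gauduchonConn H t w (Sum.inr j) (Sum.inl k) (Sum.inl e) =
      t * bismutMixed H w j k e := by
  simp [gauduchonConn, chernConn, bismutConn]

theorem gauduchonConn_inl_inr (H : Cn n → Matrix (Fin n) (Fin n) ℂ) (t : ℝ) (A : Ix n)
    (k e : Fin n) (w : Cn n) : gauduchonConn H t w A (Sum.inl k) (Sum.inr e) = 0 := by
  rcases A with i | i <;> simp [gauduchonConn, chernConn, bismutConn]

namespace IsLocalMetric

variable {U : Set (Cn n)} {H : Cn n → Matrix (Fin n) (Fin n) ℂ} {z : Cn n}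

/-- The connection preserves type, so the intermediate indices run over `(1,0)` vectors only and the
metric merely lowers the last index. -/
theorem curvature_eq (hH : IsLocalMetric U H) (hz : z ∈ U) (t : ℝ) (i j k l : Fin n) :
    curvature H (gauduchonConn H t) z (Sum.inl i) (Sum.inr j) (Sum.inl k) (Sum.inr l) =
      ∑ e, mixedCurvature H t z i j k e * H z e l := by
  simp only [curvature, Fintype.sum_sum_type, gC, mul_zero, Finset.sum_const_zero, add_zero,
    gauduchonConn_inl_inr, zero_mul, sub_self, frameDeriv, gauduchonConn_inl, gauduchonConn_inr]
  refine Finset.sum_congr rfl fun e _ => ?_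
  congr 1
  have hB := hH.differentiableAt hz (hH.smooth_bismutMixed j k e)
  have hC := hH.differentiableAt hz (hH.smooth_chernCoeff i k e)
  have hT := hH.differentiableAt hz (hH.smooth_chernTorsion i k e)
  have h1 : dzbar j (fun w => gauduchonCoeff H t w i k e) z =
      dzbar j (fun w => chernCoeff H w i k e) z - t * dzbar j (fun w => chernTorsion H w i k e) z := by
    rw [← dzbar_const_mul _ _ hT, ← dzbar_sub _ hC (hT.const_mul _)]
    rfl
  rw [dz_const_mul _ _ hB, h1, mixedCurvature, Finset.sum_sub_distrib, Finset.mul_sum,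
    Finset.mul_sum]
  simp only [mul_assoc, mul_left_comm]
  ring

theorem localScalar1_eq (hH : IsLocalMetric U H) (hz : z ∈ U) (t : ℝ) :
    localScalar1 H t z = ∑ i, ∑ j, (H z)⁻¹ j i * ∑ k, mixedCurvature H t z i j k k := by
  simp only [localScalar1, hH.curvature_eq hz]
  refine Finset.sum_congr rfl fun i _ => Finset.sum_congr rfl fun j _ => ?_
  rw [Finset.mul_sum]
  refine Finset.sum_congr rfl fun k _ => ?_
  simp only [mul_assoc, ← Finset.mul_sum]
  congr 1
  simp only [Finset.mul_sum]
  rw [Finset.sum_comm]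
  have h : ∀ e, ∑ l, (H z)⁻¹ l k * (mixedCurvature H t z i j k e * H z e l) =
      mixedCurvature H t z i j k e * if e = k then 1 else 0 := fun e => by
    rw [← hH.sum_mul_inv hz, Finset.mul_sum]
    exact Finset.sum_congr rfl fun l _ => by ring
  simp [h]

theorem localScalar2_eq (hH : IsLocalMetric U H) (hz : z ∈ U) (t : ℝ) :
    localScalar2 H t z = ∑ j, ∑ k, (H z)⁻¹ j k * ∑ i, mixedCurvature H t z i j k i := by
  simp only [localScalar2, hH.curvature_eq hz]
  have h : ∀ i j k, ∑ l, (H z)⁻¹ l i * (H z)⁻¹ j k * ∑ e, mixedCurvature H t z i j k e * H z e l =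
      (H z)⁻¹ j k * mixedCurvature H t z i j k i := fun i j k => by
    simp only [Finset.mul_sum]
    rw [Finset.sum_comm]
    have h : ∀ e, ∑ l, (H z)⁻¹ l i * (H z)⁻¹ j k * (mixedCurvature H t z i j k e * H z e l) =
        (H z)⁻¹ j k * mixedCurvature H t z i j k e * if e = i then 1 else 0 := fun e => by
      rw [← hH.sum_mul_inv hz, Finset.mul_sum]
      exact Finset.sum_congr rfl fun l _ => by ring
    simp [h]
  simp only [h]
  simp only [Finset.mul_sum]
  rw [Finset.sum_comm]
  exact Finset.sum_congr rfl fun j _ => Finset.sum_comm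

/-- The endomorphism trace of the `(0,1)` part of the Bismut connection. It governs `S⁽¹⁾`, while
the metric trace in `sum_inv_mul_bismutMixed` governs `S⁽²⁾`. -/
theorem sum_bismutMixed_self (hH : IsLocalMetric U H) (hz : z ∈ U) (j : Fin n) :
    ∑ k, bismutMixed H z j k k = conj (torsionTrace H z j) := by
  have h : ∀ q r, ∑ k, (H z)⁻¹ q k * H z k r * conj (chernTorsion H z j q r) =
      (if q = r then 1 else 0) * conj (chernTorsion H z j q r) := fun q r => by
    rw [← hH.sum_inv_mul hz, Finset.sum_mul]
  simp only [bismutMixed]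
  rw [Finset.sum_comm]
  simp only [Finset.sum_comm (s := Finset.univ) (t := Finset.univ)
    (f := fun k r => (H z)⁻¹ _ k * H z k r * conj (chernTorsion H z j _ r)), h, torsionTrace,
    map_sum]
  simp

theorem chernTorsion_swap (H : Cn n → Matrix (Fin n) (Fin n) ℂ) (z : Cn n) (i k l : Fin n) :
    chernTorsion H z k i l = -chernTorsion H z i k l := by
  simp [chernTorsion]

theorem sum_inv_mul_bismutMixed (hH : IsLocalMetric U H) (hz : z ∈ U) (i : Fin n) :
    ∑ j, ∑ k, (H z)⁻¹ j k * bismutMixed H z j k i =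
      -∑ q, (H z)⁻¹ q i * conj (torsionTrace H z q) := by
  have h : ∀ j q r, ∑ k, (H z)⁻¹ j k * ((H z)⁻¹ q i * H z k r * conj (chernTorsion H z j q r)) =
      (if j = r then 1 else 0) * ((H z)⁻¹ q i * conj (chernTorsion H z j q r)) := fun j q r => by
    rw [← hH.sum_inv_mul hz, Finset.sum_mul]
    exact Finset.sum_congr rfl fun k _ => by ring
  have h1 : ∀ j, ∑ k, (H z)⁻¹ j k * bismutMixed H z j k i =
      ∑ q, (H z)⁻¹ q i * conj (chernTorsion H z j q j) := fun j => by
    simp only [bismutMixed, Finset.mul_sum]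
    rw [Finset.sum_comm]
    refine Finset.sum_congr rfl fun q _ => ?_
    rw [Finset.sum_comm]
    simp [h]
  simp only [h1]
  rw [Finset.sum_comm, ← Finset.sum_neg_distrib]
  refine Finset.sum_congr rfl fun q _ => ?_
  rw [torsionTrace, map_sum, Finset.mul_sum, ← Finset.sum_neg_distrib]
  refine Finset.sum_congr rfl fun j _ => ?_
  rw [chernTorsion_swap H z q j j, map_neg]
  ring

end IsLocalMetric

/-! ### The difference of the scalar curvatures of a Gauduchon metric -/

/-- `h^{i q̄} \overline{τ_q}`. -/
def torsionVector (H : Cn n → Matrix (Fin n) (Fin n) ℂ) (z : Cn n) (i : Fin n) : ℂ :=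
  ∑ q, (H z)⁻¹ q i * conj (torsionTrace H z q)

/-- The equation `∂∂̄ω^{n-1} = 0` in terms of the adjugate matrix of `h`. -/
def IsGauduchonAt (H : Cn n → Matrix (Fin n) (Fin n) ℂ) (z : Cn n) : Prop :=
  ∑ s, dz s (fun w => conj (∑ k, dz k (fun v => (H v).adjugate s k) w)) z = 0

namespace IsLocalMetric

variable {U : Set (Cn n)} {H : Cn n → Matrix (Fin n) (Fin n) ℂ} {z : Cn n}

theorem conj_det (hH : IsLocalMetric U H) (w : Cn n) : conj (H w).det = (H w).det := by
  have := Matrix.det_conjTranspose (H w)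
  rw [(hH.herm w).eq] at this
  exact this.symm

theorem conj_torsionTraceNormSq (hH : IsLocalMetric U H) :
    conj (torsionTraceNormSq H z) = torsionTraceNormSq H z := by
  simp only [torsionTraceNormSq, map_sum, map_mul, Complex.conj_conj, hH.conj_inv]
  rw [Finset.sum_comm]
  exact Finset.sum_congr rfl fun i _ => Finset.sum_congr rfl fun j _ => by ring

theorem sum_torsionVector_mul (H : Cn n → Matrix (Fin n) (Fin n) ℂ) (z : Cn n) :
    ∑ i, torsionVector H z i * torsionTrace H z i = torsionTraceNormSq H z := by
  simp only [torsionVector, torsionTraceNormSq, Finset.sum_mul]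
  exact Finset.sum_congr rfl fun i _ => Finset.sum_congr rfl fun j _ => by ring

theorem smooth_torsionVector (hH : IsLocalMetric U H) (i : Fin n) :
    ContDiffOn ℝ ∞ (fun w => torsionVector H w i) U :=
  ContDiffOn.sum fun q _ => (hH.smooth_inv q i).mul (contDiffOn_conj (hH.smooth_torsionTrace q))

theorem conj_sum_dz_adjugate (hH : IsLocalMetric U H) (hz : z ∈ U) (s : Fin n) :
    conj (∑ k, dz k (fun v => (H v).adjugate s k) z) = (H z).det * torsionVector H z s := by
  simp only [hH.sum_dz_adjugate hz, torsionVector, map_mul, map_sum, hH.conj_det, hH.conj_inv]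

/-- The Gauduchon equation reads `∂_s (det h · V^s) = 0` with `V = torsionVector`; expand with `∂_s
det h = Γ_{sk}^k det h` and divide by `det h`. -/
theorem sum_dz_torsionVector (hH : IsLocalMetric U H) (hz : z ∈ U) (hG : IsGauduchonAt H z) :
    ∑ s, dz s (fun w => torsionVector H w s) z =
      -∑ s, (∑ k, chernCoeff H z s k k) * torsionVector H z s := by
  have hdet := hH.differentiableAt hz hH.smooth_det
  have h1 : ∀ s, dz s (fun w => conj (∑ k, dz k (fun v => (H v).adjugate s k) w)) z =
      (H z).det * ((∑ k, chernCoeff H z s k k) * torsionVector H z s +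
        dz s (fun w => torsionVector H w s) z) := fun s => by
    rw [dz_congr s (g := fun w => (H w).det * torsionVector H w s),
      dz_mul s hdet (hH.differentiableAt hz (hH.smooth_torsionVector s)), hH.dz_det hz]
    · ring
    · filter_upwards [hH.eventually_mem hz] with w hw using hH.conj_sum_dz_adjugate hw s
  simp only [IsGauduchonAt, h1, ← Finset.mul_sum, mul_eq_zero, hH.det_ne_zero hz, false_or,
    Finset.sum_add_distrib] at hG
  exact eq_neg_of_add_eq_zero_right hG

/-- Compare with the divergence of `V`: moving `h⁻¹` out of the derivative yields `Γ_{sp}^s V^p`,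
the Gauduchon equation yields `-Γ_{sk}^k V^s`, and the two add up to `-τ_s V^s = -|τ|²`. -/
theorem sum_inv_mul_dz_conj (hH : IsLocalMetric U H) (hz : z ∈ U) (hG : IsGauduchonAt H z) :
    ∑ i, ∑ j, (H z)⁻¹ j i * dz i (fun w => conj (torsionTrace H w j)) z =
      -torsionTraceNormSq H z := by
  have hdi : ∀ i j, DifferentiableAt ℝ (fun w => (H w)⁻¹ i j) z := fun i j =>
    hH.differentiableAt hz (hH.smooth_inv i j)
  have hdc : ∀ j, DifferentiableAt ℝ (fun w => conj (torsionTrace H w j)) z := fun j =>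
    hH.differentiableAt hz (contDiffOn_conj (hH.smooth_torsionTrace j))
  have h1 : ∀ s, dz s (fun w => torsionVector H w s) z =
      (∑ j, (H z)⁻¹ j s * dz s (fun w => conj (torsionTrace H w j)) z) -
        ∑ j, ∑ p, (H z)⁻¹ j p * chernCoeff H z s p s * conj (torsionTrace H z j) := fun s => by
    simp only [torsionVector]
    rw [dz_sum s _ (f := fun j w => (H w)⁻¹ j s * conj (torsionTrace H w j))
      fun j _ => (hdi j s).mul (hdc j), ← Finset.sum_sub_distrib]
    refine Finset.sum_congr rfl fun j _ => ?_
    rw [dz_mul s (hdi j s) (hdc j), hH.dz_inv hz, ← Finset.sum_mul]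
    ring
  have h2 := hH.sum_dz_torsionVector hz hG
  simp only [h1, Finset.sum_sub_distrib] at h2
  have h3 : ∑ s, ∑ j, ∑ p, (H z)⁻¹ j p * chernCoeff H z s p s * conj (torsionTrace H z j) =
      ∑ p, (∑ s, chernCoeff H z s p s) * torsionVector H z p := by
    simp only [torsionVector, Finset.sum_mul, Finset.mul_sum]
    calc _ = ∑ s, ∑ p, ∑ j, _ := Finset.sum_congr rfl fun s _ => Finset.sum_comm
      _ = ∑ p, ∑ s, ∑ j, _ := Finset.sum_comm
      _ = ∑ p, ∑ j, ∑ s, _ := Finset.sum_congr rfl fun p _ => Finset.sum_comm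
      _ = _ := Finset.sum_congr rfl fun p _ => Finset.sum_congr rfl fun s _ =>
        Finset.sum_congr rfl fun j _ => by ring
  rw [h3, sub_eq_iff_eq_add] at h2
  rw [h2, ← sum_torsionVector_mul, neg_add_eq_sub, ← Finset.sum_sub_distrib,
    ← Finset.sum_neg_distrib]
  refine Finset.sum_congr rfl fun s _ => ?_
  simp only [torsionTrace, chernTorsion, Finset.sum_sub_distrib]
  ring

theorem sum_inv_mul_dzbar (hH : IsLocalMetric U H) (hz : z ∈ U) (hG : IsGauduchonAt H z) :
    ∑ i, ∑ j, (H z)⁻¹ j i * dzbar j (fun w => torsionTrace H w i) z =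
      -torsionTraceNormSq H z := by
  have h := congrArg conj (hH.sum_inv_mul_dz_conj hz hG)
  simp only [dz_conj, map_sum, map_mul, Complex.conj_conj, hH.conj_inv, map_neg,
    hH.conj_torsionTraceNormSq] at h
  rw [← h, Finset.sum_comm]

/-- The quadratic terms form a commutator of endomorphisms, so they disappear from the trace; what
remains is the curvature of the induced connection on the determinant bundle. -/
theorem sum_mixedCurvature_self (hH : IsLocalMetric U H) (hz : z ∈ U) (t : ℝ) (i j : Fin n) :
    ∑ k, mixedCurvature H t z i j k k = t * dz i (fun w => conj (torsionTrace H w j)) z -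
      ∑ k, dzbar j (fun w => chernCoeff H w i k k) z +
      t * dzbar j (fun w => torsionTrace H w i) z := by
  have h1 : dz i (fun w => conj (torsionTrace H w j)) z =
      ∑ k, dz i (fun w => bismutMixed H w j k k) z := by
    rw [← dz_sum i _ fun k _ => hH.differentiableAt hz (hH.smooth_bismutMixed j k k)]
    refine dz_congr i ?_
    filter_upwards [hH.eventually_mem hz] with w hw using (hH.sum_bismutMixed_self hw j).symm
  have h2 : dzbar j (fun w => torsionTrace H w i) z =
      ∑ k, dzbar j (fun w => chernTorsion H w i k k) z :=
    dzbar_sum j _ fun k _ => hH.differentiableAt hz (hH.smooth_chernTorsion i k k)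
  have h3 : ∑ k, ∑ f, bismutMixed H z j k f * gauduchonCoeff H t z i f k =
      ∑ k, ∑ f, gauduchonCoeff H t z i k f * bismutMixed H z j f k := by
    rw [Finset.sum_comm]
    exact Finset.sum_congr rfl fun k _ => Finset.sum_congr rfl fun f _ => mul_comm _ _
  simp only [mixedCurvature, Finset.sum_add_distrib, Finset.sum_sub_distrib, ← Finset.mul_sum]
  rw [h1, h2, h3]
  ring

theorem localScalar1_eq_of_isGauduchonAt (hH : IsLocalMetric U H) (hz : z ∈ U)
    (hG : IsGauduchonAt H z) (t : ℝ) :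
    localScalar1 H t z = -2 * t * torsionTraceNormSq H z -
      ∑ i, ∑ j, (H z)⁻¹ j i * ∑ k, dzbar j (fun w => chernCoeff H w i k k) z := by
  have h1 := hH.sum_inv_mul_dz_conj hz hG
  have h2 := hH.sum_inv_mul_dzbar hz hG
  have h : localScalar1 H t z =
      t * (∑ i, ∑ j, (H z)⁻¹ j i * dz i (fun w => conj (torsionTrace H w j)) z) -
      (∑ i, ∑ j, (H z)⁻¹ j i * ∑ k, dzbar j (fun w => chernCoeff H w i k k) z) +
      t * ∑ i, ∑ j, (H z)⁻¹ j i * dzbar j (fun w => torsionTrace H w i) z := by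
    simp only [hH.localScalar1_eq hz, hH.sum_mixedCurvature_self hz, Finset.mul_sum,
      ← Finset.sum_add_distrib, ← Finset.sum_sub_distrib]
    refine Finset.sum_congr rfl fun i _ => Finset.sum_congr rfl fun j _ => ?_
    rw [mul_add, mul_sub, Finset.mul_sum]
    ring
  rw [h, h1, h2]
  ring

/-- Product rule for the contraction of `sum_inv_mul_bismutMixed`. The derivative of `h⁻¹` leaves a
`Γ · B` term, with `B = bismutMixed`, which is designed to cancel against a quadratic term of the
curvature in `S⁽²⁾`. -/
theorem sum_inv_mul_dz_bismutMixed (hH : IsLocalMetric U H) (hz : z ∈ U) :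
    ∑ j, ∑ k, (H z)⁻¹ j k * ∑ i, dz i (fun w => bismutMixed H w j k i) z =
      -(∑ i, dz i (fun w => torsionVector H w i) z) +
        ∑ j, ∑ k, ∑ i, (H z)⁻¹ j k * ∑ f, chernCoeff H z i k f * bismutMixed H z j f i := by
  have hB : ∀ j k i, DifferentiableAt ℝ (fun w => bismutMixed H w j k i) z := fun j k i =>
    hH.differentiableAt hz (hH.smooth_bismutMixed j k i)
  have hdi : ∀ i j, DifferentiableAt ℝ (fun w => (H w)⁻¹ i j) z := fun i j =>
    hH.differentiableAt hz (hH.smooth_inv i j)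
  have h1 : ∀ i, -dz i (fun w => torsionVector H w i) z =
      ∑ j, ∑ k, (H z)⁻¹ j k * dz i (fun w => bismutMixed H w j k i) z -
      ∑ j, ∑ k, (∑ p, (H z)⁻¹ j p * chernCoeff H z i p k) * bismutMixed H z j k i := fun i => by
    have h2 : -dz i (fun w => torsionVector H w i) z =
        dz i (fun w => ∑ j, ∑ k, (H w)⁻¹ j k * bismutMixed H w j k i) z := by
      have h3 := frameDeriv_neg (A := Sum.inl i)
        (hH.differentiableAt hz (hH.smooth_torsionVector i))
      refine h3.symm.trans (dz_congr i ?_)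
      filter_upwards [hH.eventually_mem hz] with w hw using (hH.sum_inv_mul_bismutMixed hw i).symm
    rw [h2, dz_sum i _ (f := fun j w => ∑ k, (H w)⁻¹ j k * bismutMixed H w j k i)
      fun j _ => DifferentiableAt.fun_sum fun k _ => (hdi j k).mul (hB j k i),
      ← Finset.sum_sub_distrib]
    refine Finset.sum_congr rfl fun j _ => ?_
    rw [dz_sum i _ (f := fun k w => (H w)⁻¹ j k * bismutMixed H w j k i)
      fun k _ => (hdi j k).mul (hB j k i), ← Finset.sum_sub_distrib]
    refine Finset.sum_congr rfl fun k _ => ?_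
    rw [dz_mul i (hdi j k) (hB j k i), hH.dz_inv hz]
    ring
  rw [← Finset.sum_neg_distrib]
  simp only [h1, Finset.sum_sub_distrib, Finset.mul_sum, Finset.sum_mul]
  have h4 : ∑ i, ∑ j, ∑ k, (H z)⁻¹ j k * dz i (fun w => bismutMixed H w j k i) z =
      ∑ j, ∑ k, ∑ i, (H z)⁻¹ j k * dz i (fun w => bismutMixed H w j k i) z := by
    rw [Finset.sum_comm]
    exact Finset.sum_congr rfl fun j _ => Finset.sum_comm
  have h5 : ∑ i, ∑ j, ∑ k, ∑ p, (H z)⁻¹ j p * chernCoeff H z i p k * bismutMixed H z j k i =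
      ∑ j, ∑ k, ∑ i, ∑ f, (H z)⁻¹ j k * (chernCoeff H z i k f * bismutMixed H z j f i) := by
    rw [Finset.sum_comm]
    refine Finset.sum_congr rfl fun j _ => ?_
    rw [Finset.sum_comm (s := Finset.univ (α := Fin n)) (t := Finset.univ (α := Fin n))
      (f := fun k i => ∑ f, (H z)⁻¹ j k * (chernCoeff H z i k f * bismutMixed H z j f i))]
    refine Finset.sum_congr rfl fun i _ => ?_
    rw [Finset.sum_comm]
    exact Finset.sum_congr rfl fun k _ => Finset.sum_congr rfl fun p _ => by ring
  rw [h4, h5]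
  ring

theorem sum_rotate (F : Fin n → Fin n → Fin n → Fin n → ℂ) :
    ∑ j, ∑ k, ∑ i, ∑ q, F j k i q = ∑ i, ∑ q, ∑ k, ∑ j, F j k i q := by
  calc _ = ∑ j, ∑ i, ∑ k, ∑ q, F j k i q := Finset.sum_congr rfl fun j _ => Finset.sum_comm
    _ = ∑ i, ∑ j, ∑ k, ∑ q, F j k i q := Finset.sum_comm
    _ = ∑ i, ∑ j, ∑ q, ∑ k, F j k i q := Finset.sum_congr rfl fun i _ =>
      Finset.sum_congr rfl fun j _ => Finset.sum_comm
    _ = ∑ i, ∑ q, ∑ j, ∑ k, F j k i q := Finset.sum_congr rfl fun i _ => Finset.sum_comm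
    _ = _ := Finset.sum_congr rfl fun i _ => Finset.sum_congr rfl fun q _ => Finset.sum_comm

theorem sum_bismutMixed_mul_torsion (H : Cn n → Matrix (Fin n) (Fin n) ℂ) (z : Cn n) :
    ∑ j, ∑ k, ∑ i, (H z)⁻¹ j k * ∑ f, chernTorsion H z i k f * bismutMixed H z j f i =
      -torsionNormSq H z := by
  have h : ∀ i j k, (H z)⁻¹ j k * ∑ f, chernTorsion H z i k f * bismutMixed H z j f i =
      -∑ q, ∑ f, ∑ r, (H z)⁻¹ q i * (H z)⁻¹ j k * H z f r *
        (chernTorsion H z i k f * conj (chernTorsion H z q j r)) := fun i j k => by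
    simp only [bismutMixed, Finset.mul_sum, ← Finset.sum_neg_distrib]
    rw [Finset.sum_comm]
    refine Finset.sum_congr rfl fun q _ => Finset.sum_congr rfl fun f _ =>
      Finset.sum_congr rfl fun r _ => ?_
    rw [chernTorsion_swap H z q j r, map_neg]
    ring
  simp only [h, Finset.sum_neg_distrib, torsionNormSq]
  refine congrArg Neg.neg ?_
  exact sum_rotate fun j k i q => ∑ f, ∑ r, (H z)⁻¹ q i * (H z)⁻¹ j k * H z f r *
    (chernTorsion H z i k f * conj (chernTorsion H z q j r))

theorem sum_gauduchonCoeff_self (H : Cn n → Matrix (Fin n) (Fin n) ℂ) (t : ℝ) (z : Cn n)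
    (f : Fin n) : ∑ i, gauduchonCoeff H t z i f i =
      ∑ i, chernCoeff H z f i i - (1 - t) * torsionTrace H z f := by
  simp only [gauduchonCoeff, torsionTrace, chernTorsion, Finset.sum_sub_distrib, ← Finset.mul_sum]
  ring

/-- Two cancellations occur. The `Γ · B` terms cancel up to the torsion part of the Gauduchon
coefficients, leaving `-t²|T|²`. The terms `Γ_{sk}^k V^s` from the divergence of `V` and from the
other quadratic term cancel and leave `t(1 - t)|τ|²`; the derivative of `τ` adds a further `t|τ|²`.
-/
theorem localScalar2_eq_of_isGauduchonAt (hH : IsLocalMetric U H) (hz : z ∈ U)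
    (hG : IsGauduchonAt H z) (t : ℝ) :
    localScalar2 H t z = (2 * t - t ^ 2) * torsionTraceNormSq H z -
      t ^ 2 * torsionNormSq H z -
      ∑ j, ∑ k, (H z)⁻¹ j k * ∑ i, dzbar j (fun w => chernCoeff H w i k i) z := by
  have hT : ∀ j k, ∑ i, dzbar j (fun w => chernTorsion H w i k i) z =
      -dzbar j (fun w => torsionTrace H w k) z := fun j k => by
    have h := dzbar_sum j Finset.univ (f := fun i w => chernTorsion H w k i i)
      fun i _ => hH.differentiableAt hz (hH.smooth_chernTorsion k i i)
    simp only [torsionTrace]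
    rw [h, ← Finset.sum_neg_distrib]
    refine Finset.sum_congr rfl fun i _ => ?_
    have h' := frameDeriv_neg (A := Sum.inr j)
      (hH.differentiableAt hz (hH.smooth_chernTorsion k i i))
    refine Eq.trans ?_ h'
    simp only [chernTorsion_swap H _ k i i, frameDeriv]
  have hD : ∑ j, ∑ k, (H z)⁻¹ j k * ∑ i, ∑ f, bismutMixed H z j k f * gauduchonCoeff H t z i f i =
      -∑ f, torsionVector H z f *
        (∑ i, chernCoeff H z f i i - (1 - t) * torsionTrace H z f) := by
    simp only [← sum_gauduchonCoeff_self]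
    have h : ∀ f, torsionVector H z f = -∑ j, ∑ k, (H z)⁻¹ j k * bismutMixed H z j k f := fun f => by
      rw [hH.sum_inv_mul_bismutMixed hz, neg_neg, torsionVector]
    simp only [h, neg_mul, Finset.sum_neg_distrib, neg_neg, Finset.sum_mul, Finset.mul_sum]
    symm
    calc _ = ∑ f, ∑ j, ∑ i, ∑ k, _ := Finset.sum_congr rfl fun f _ => Finset.sum_comm
      _ = ∑ j, ∑ f, ∑ i, ∑ k, _ := Finset.sum_comm
      _ = ∑ j, ∑ f, ∑ k, ∑ i, _ := Finset.sum_congr rfl fun j _ =>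
        Finset.sum_congr rfl fun f _ => Finset.sum_comm
      _ = ∑ j, ∑ k, ∑ f, ∑ i, _ := Finset.sum_congr rfl fun j _ => Finset.sum_comm
      _ = ∑ j, ∑ k, ∑ i, ∑ f, _ := Finset.sum_congr rfl fun j _ =>
        Finset.sum_congr rfl fun k _ => Finset.sum_comm
      _ = _ := Finset.sum_congr rfl fun j _ => Finset.sum_congr rfl fun k _ =>
        Finset.sum_congr rfl fun i _ => Finset.sum_congr rfl fun f _ => by ring
  have hE : ∑ j, ∑ k, (H z)⁻¹ j k * ∑ i, ∑ f, gauduchonCoeff H t z i k f * bismutMixed H z j f i =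
      (∑ j, ∑ k, ∑ i, (H z)⁻¹ j k * ∑ f, chernCoeff H z i k f * bismutMixed H z j f i) +
        t * torsionNormSq H z := by
    rw [← neg_neg (torsionNormSq H z), ← sum_bismutMixed_mul_torsion, mul_neg, ← sub_eq_add_neg]
    simp only [Finset.mul_sum, ← Finset.sum_sub_distrib]
    refine Finset.sum_congr rfl fun j _ => Finset.sum_congr rfl fun k _ =>
      Finset.sum_congr rfl fun i _ => Finset.sum_congr rfl fun f _ => ?_
    rw [gauduchonCoeff]
    ring
  have h : localScalar2 H t z =
      t * (∑ j, ∑ k, (H z)⁻¹ j k * ∑ i, dz i (fun w => bismutMixed H w j k i) z) -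
      (∑ j, ∑ k, (H z)⁻¹ j k * ∑ i, dzbar j (fun w => chernCoeff H w i k i) z) -
      t * (∑ j, ∑ k, (H z)⁻¹ j k * dzbar j (fun w => torsionTrace H w k) z) +
      (t * (∑ j, ∑ k, (H z)⁻¹ j k *
        ∑ i, ∑ f, bismutMixed H z j k f * gauduchonCoeff H t z i f i) -
      t * ∑ j, ∑ k, (H z)⁻¹ j k *
        ∑ i, ∑ f, gauduchonCoeff H t z i k f * bismutMixed H z j f i) := by
    rw [hH.localScalar2_eq hz]
    simp only [mixedCurvature, Finset.sum_add_distrib, Finset.sum_sub_distrib, ← Finset.mul_sum, hT,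
      mul_add, mul_sub, mul_neg, Finset.sum_neg_distrib, mul_left_comm _ (t : ℂ)]
    ring
  have h2 : ∑ j, ∑ k, (H z)⁻¹ j k * dzbar j (fun w => torsionTrace H w k) z =
      -torsionTraceNormSq H z := by
    rw [← hH.sum_inv_mul_dzbar hz hG, Finset.sum_comm]
  have h3 := hH.sum_dz_torsionVector hz hG
  have h4 : ∑ f, torsionVector H z f *
        (∑ i, chernCoeff H z f i i - (1 - t) * torsionTrace H z f) =
      ∑ s, (∑ k, chernCoeff H z s k k) * torsionVector H z s -
        (1 - t) * torsionTraceNormSq H z := by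
    rw [← sum_torsionVector_mul, Finset.mul_sum, ← Finset.sum_sub_distrib]
    exact Finset.sum_congr rfl fun f _ => by ring
  rw [h, hE, hD, h4, hH.sum_inv_mul_dz_bismutMixed hz, h3, h2]
  ring

/-- For a Gauduchon metric the scalar curvatures of the Gauduchon connection `∇^t` satisfy
`S⁽¹⁾ - S⁽²⁾ = (t² - 4t + 1) |τ|² + t² |T|²`. -/
theorem localScalar1_sub_localScalar2 (hH : IsLocalMetric U H) (hz : z ∈ U)
    (hG : IsGauduchonAt H z) (t : ℝ) :
    localScalar1 H t z - localScalar2 H t z =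
      (t ^ 2 - 4 * t + 1) * torsionTraceNormSq H z + t ^ 2 * torsionNormSq H z := by
  -- The Chern parts of the two scalar curvatures differ by antisymmetrization of the lower indices
  -- of `Γ`, that is by `h^{i j̄} ∂_j̄ τ_i`; this is the source of the constant term `1` in `t² - 4t
  -- + 1`.
  have h1 : ∑ i, ∑ j, (H z)⁻¹ j i * ∑ k, dzbar j (fun w => chernCoeff H w i k k) z -
      ∑ j, ∑ k, (H z)⁻¹ j k * ∑ i, dzbar j (fun w => chernCoeff H w i k i) z =
      -torsionTraceNormSq H z := by
    rw [← hH.sum_inv_mul_dzbar hz hG, Finset.sum_comm (s := Finset.univ (α := Fin n))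
      (f := fun j k => (H z)⁻¹ j k * ∑ i, dzbar j (fun w => chernCoeff H w i k i) z),
      ← Finset.sum_sub_distrib]
    refine Finset.sum_congr rfl fun i _ => ?_
    rw [← Finset.sum_sub_distrib]
    refine Finset.sum_congr rfl fun j _ => ?_
    have h := dzbar_sum j Finset.univ (f := fun k w => chernTorsion H w i k k)
      fun k _ => hH.differentiableAt hz (hH.smooth_chernTorsion i k k)
    simp only [torsionTrace]
    rw [h, ← mul_sub, ← Finset.sum_sub_distrib]
    congr 1
    refine Finset.sum_congr rfl fun k _ => ?_
    exact (dzbar_sub j (hH.differentiableAt hz (hH.smooth_chernCoeff i k k))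
      (hH.differentiableAt hz (hH.smooth_chernCoeff k i k))).symm
  rw [hH.localScalar1_eq_of_isGauduchonAt hz hG, hH.localScalar2_eq_of_isGauduchonAt hz hG]
  linear_combination -h1

end IsLocalMetric

/-! ### Powers of the fundamental form -/

/-- The minor of `A` with rows `a` and columns `b`. -/
def minor {n k : ℕ} (A : Matrix (Fin n) (Fin n) ℂ) (a b : Fin k → Fin n) : ℂ :=
  (A.submatrix a b).det

/-- Extension of a permutation of `Fin k` fixing the last element of `Fin (k + 1)`. -/
def extendLast {k : ℕ} (ρ : Equiv.Perm (Fin k)) : Equiv.Perm (Fin (k + 1)) :=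
  finSumFinEquiv.permCongr (Equiv.Perm.sumCongr ρ (1 : Equiv.Perm (Fin 1)))

theorem extendLast_castAdd {k : ℕ} (ρ : Equiv.Perm (Fin k)) (s : Fin k) :
    extendLast ρ (Fin.castAdd 1 s) = Fin.castAdd 1 (ρ s) := by
  simp [extendLast, Equiv.permCongr_apply]

theorem extendLast_natAdd {k : ℕ} (ρ : Equiv.Perm (Fin k)) (s : Fin 1) :
    extendLast ρ (Fin.natAdd k s) = Fin.natAdd k s := by
  simp [extendLast, Equiv.permCongr_apply]

theorem sign_extendLast {k : ℕ} (ρ : Equiv.Perm (Fin k)) :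
    Equiv.Perm.sign (extendLast ρ) = Equiv.Perm.sign ρ := by
  simp [extendLast, Equiv.Perm.sign_permCongr]

/-- For fixed `τ`, permuting the columns by `τ` changes the determinant by its sign, which the
factor `sign τ` undoes; each of the `k!` permutations therefore contributes the same determinant. -/
theorem sum_sum_sign_prod {k : ℕ} (A : Matrix (Fin k) (Fin k) ℂ) :
    ∑ σ : Equiv.Perm (Fin k), ∑ τ : Equiv.Perm (Fin k),
      ((Equiv.Perm.sign σ : ℤ) : ℂ) * ((Equiv.Perm.sign τ : ℤ) : ℂ) * ∏ s, A (σ s) (τ s) =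
      k.factorial * A.det := by
  rw [Finset.sum_comm]
  have h : ∀ τ : Equiv.Perm (Fin k), ∑ σ : Equiv.Perm (Fin k),
      ((Equiv.Perm.sign σ : ℤ) : ℂ) * ((Equiv.Perm.sign τ : ℤ) : ℂ) * ∏ s, A (σ s) (τ s) =
      A.det := fun τ => by
    have h1 : ((Equiv.Perm.sign τ : ℤ) : ℂ) * ((Equiv.Perm.sign τ : ℤ) : ℂ) = 1 := by
      norm_cast
      exact Int.units_coe_mul_self _
    have h2 := Matrix.det_permute' τ A
    rw [Matrix.det_apply'] at h2
    calc _ = ((Equiv.Perm.sign τ : ℤ) : ℂ) * ∑ σ : Equiv.Perm (Fin k),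
          ((Equiv.Perm.sign σ : ℤ) : ℂ) * ∏ s, A.submatrix id τ (σ s) s := by
          rw [Finset.mul_sum]
          exact Finset.sum_congr rfl fun σ _ => by simp only [Matrix.submatrix_apply, id]; ring
      _ = A.det := by rw [h2, ← mul_assoc, h1, one_mul]
  simp [h, Fintype.card_perm]

/-- The combinatorics of `ωᵏ ∧ ω`. Expand the minor over `ρ` in `S_k`, extend `ρ` by a fixed last
element and absorb it into `σ`; the sum no longer depends on `ρ`, whence the factor `k!`. -/
theorem sum_sum_sign_minor {k : ℕ} (A : Matrix (Fin (k + 1)) (Fin (k + 1)) ℂ) :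
    ∑ σ : Equiv.Perm (Fin (k + 1)), ∑ τ : Equiv.Perm (Fin (k + 1)),
      ((Equiv.Perm.sign σ : ℤ) : ℂ) * ((Equiv.Perm.sign τ : ℤ) : ℂ) *
        (minor A (fun s => σ (Fin.castAdd 1 s)) (fun s => τ (Fin.castAdd 1 s)) *
          A (σ (Fin.natAdd k 0)) (τ (Fin.natAdd k 0))) =
      k.factorial * ((k + 1).factorial * A.det) := by
  have h1 : ∀ σ τ : Equiv.Perm (Fin (k + 1)),
      minor A (fun s => σ (Fin.castAdd 1 s)) (fun s => τ (Fin.castAdd 1 s)) *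
          A (σ (Fin.natAdd k 0)) (τ (Fin.natAdd k 0)) =
      ∑ ρ : Equiv.Perm (Fin k), ((Equiv.Perm.sign ρ : ℤ) : ℂ) *
        ∏ s, A ((σ * extendLast ρ) s) (τ s) := fun σ τ => by
    rw [minor, Matrix.det_apply', Finset.sum_mul]
    refine Finset.sum_congr rfl fun ρ _ => ?_
    rw [Fin.prod_univ_add, Fin.prod_univ_one, mul_assoc]
    simp only [Equiv.Perm.mul_apply, extendLast_castAdd, extendLast_natAdd, Matrix.submatrix_apply]
  have h2 : ∀ ρ : Equiv.Perm (Fin k), ∑ σ : Equiv.Perm (Fin (k + 1)),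
      ∑ τ : Equiv.Perm (Fin (k + 1)),
      ((Equiv.Perm.sign σ : ℤ) : ℂ) * ((Equiv.Perm.sign τ : ℤ) : ℂ) *
        (((Equiv.Perm.sign ρ : ℤ) : ℂ) * ∏ s, A ((σ * extendLast ρ) s) (τ s)) =
      (k + 1).factorial * A.det := fun ρ => by
    rw [← sum_sum_sign_prod, ← Equiv.sum_comp (Equiv.mulRight (extendLast ρ)) fun σ =>
      ∑ τ : Equiv.Perm (Fin (k + 1)),
        ((Equiv.Perm.sign σ : ℤ) : ℂ) * ((Equiv.Perm.sign τ : ℤ) : ℂ) * ∏ s, A (σ s) (τ s)]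
    refine Finset.sum_congr rfl fun σ _ => Finset.sum_congr rfl fun τ _ => ?_
    simp only [Equiv.coe_mulRight, Equiv.Perm.sign_mul, sign_extendLast]
    push_cast
    ring
  simp only [h1, Finset.mul_sum]
  calc _ = ∑ σ : Equiv.Perm (Fin (k + 1)), ∑ ρ : Equiv.Perm (Fin k),
        ∑ τ : Equiv.Perm (Fin (k + 1)),
        ((Equiv.Perm.sign σ : ℤ) : ℂ) * ((Equiv.Perm.sign τ : ℤ) : ℂ) *
        (((Equiv.Perm.sign ρ : ℤ) : ℂ) * ∏ s, A ((σ * extendLast ρ) s) (τ s)) :=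
        Finset.sum_congr rfl fun σ _ => Finset.sum_comm
    _ = _ := Finset.sum_comm
    _ = ∑ ρ : Equiv.Perm (Fin k), (k + 1).factorial * A.det :=
        Finset.sum_congr rfl fun ρ _ => h2 ρ
    _ = _ := by simp [Fintype.card_perm]

/-- `ωᵏ` is a constant multiple of the `k × k` minors of `h`. -/
theorem exists_fundFormPow_eq (k : ℕ) : ∃ c : ℂ, c ≠ 0 ∧
    ∀ (H : Cn n → Matrix (Fin n) (Fin n) ℂ) z a b,
      fundFormPow H k z a b = c * minor (H z) a b := by
  induction k with
  | zero => exact ⟨1, one_ne_zero, fun H z a b => by simp [fundFormPow, minor]⟩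
  | succ k ih =>
    obtain ⟨c, hc, h⟩ := ih
    -- The wedge normalization, times the previous constant and the `√-1` of `ω`, times the
    -- factorials produced by `sum_sum_sign_minor`. Later only its being nonzero and independent of
    -- the point matters.
    refine ⟨(-1) ^ (k * 1) / ((k.factorial : ℂ) * (k.factorial : ℂ) * ((1 : ℕ).factorial : ℂ) *
      ((1 : ℕ).factorial : ℂ)) * (c * Complex.I * (k.factorial * (k + 1).factorial)), ?_,
      fun H z a b => ?_⟩
    · simp [hc, Nat.factorial_ne_zero, Complex.I_ne_zero]
    · simp only [fundFormPow, PQForm.wedge, h, fundForm]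
      have hm : minor (H z) a b = ((H z).submatrix a b).det := rfl
      rw [hm, mul_assoc _ (c * Complex.I * _) _, mul_assoc (c * Complex.I),
        mul_assoc _ _ (Matrix.det _), ← sum_sum_sign_minor ((H z).submatrix a b)]
      congr 1
      simp only [Finset.mul_sum]
      refine Finset.sum_congr rfl fun σ _ => Finset.sum_congr rfl fun τ _ => ?_
      simp only [minor, Matrix.submatrix_submatrix, Matrix.submatrix_apply, Function.comp_def]
      ring

/-- The matrix with first column `y` and the remaining columns `B`. -/
def consCol {m : ℕ} {ι : Type*} (y : ι → ℂ) (B : Matrix ι (Fin m) ℂ) :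
    Matrix ι (Fin (m + 1)) ℂ :=
  Matrix.of fun i => Fin.cons (y i) (B i)

theorem det_consCol {m : ℕ} (y : Fin (m + 1) → ℂ) (B : Matrix (Fin (m + 1)) (Fin m) ℂ) :
    (consCol y B).det = ∑ s : Fin (m + 1), (-1) ^ (s : ℕ) * y s * (B.submatrix s.succAbove id).det := by
  rw [Matrix.det_succ_column_zero]
  refine Finset.sum_congr rfl fun s _ => ?_
  congr 2

theorem mul_consCol {m : ℕ} {ι κ : Type*} [Fintype κ] (A : Matrix ι κ ℂ) (y : κ → ℂ)
    (B : Matrix κ (Fin m) ℂ) : A * consCol y B = consCol (A.mulVec y) (A * B) := by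
  ext i j
  refine Fin.cases ?_ (fun j => ?_) j <;>
    simp [consCol, Matrix.mul_apply, Matrix.mulVec, dotProduct]

/-- The rows of the identity matrix with indices `a`. -/
def rowSelect {k : ℕ} (a : Fin k → Fin n) : Matrix (Fin k) (Fin n) ℂ :=
  (1 : Matrix (Fin n) (Fin n) ℂ).submatrix a id

theorem rowSelect_mul {k : ℕ} {ι : Type*} (a : Fin k → Fin n) (B : Matrix (Fin n) ι ℂ) :
    rowSelect a * B = B.submatrix a id := by
  ext i j
  simp [rowSelect, Matrix.mul_apply, Matrix.one_apply]

/-- The components of `e_q ⌟ (dz¹ ∧ … ∧ dzⁿ)`. -/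
def contractVol {m : ℕ} (b : Fin m → Fin (m + 1)) (q : Fin (m + 1)) : ℂ :=
  (consCol (Pi.single q 1) (rowSelect b).transpose).det

theorem det_consCol_rowSelect {m : ℕ} (b : Fin m → Fin (m + 1)) (y : Fin (m + 1) → ℂ) :
    (consCol y (rowSelect b).transpose).det = ∑ q, y q * contractVol b q := by
  have h : ∀ q, contractVol b q =
      (-1) ^ (q : ℕ) * ((rowSelect b).transpose.submatrix q.succAbove id).det := fun q => by
    rw [contractVol, det_consCol, Finset.sum_eq_single q]
    · simp
    · intro s _ hs
      simp [hs]
    · simp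
  rw [det_consCol]
  exact Finset.sum_congr rfl fun q _ => by rw [h]; ring

/-- If the index list omits only `p`, deleting row `q` from the selected columns leaves a zero row
unless `q = p`. These lists isolate single coefficients of an `(n-1)`-form. -/
theorem contractVol_succAbove {m : ℕ} (p q : Fin (m + 1)) :
    contractVol p.succAbove q = if p = q then (-1) ^ (q : ℕ) else 0 := by
  rw [contractVol, det_consCol, Finset.sum_eq_single q]
  · have h1 : (rowSelect p.succAbove).transpose.submatrix q.succAbove id =
        (1 : Matrix (Fin (m + 1)) (Fin (m + 1)) ℂ).submatrix q.succAbove p.succAbove := by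
      ext i j
      simp [rowSelect, Matrix.one_apply, eq_comm]
    rw [h1]
    split_ifs with h
    · subst h
      rw [Matrix.submatrix_one _ Fin.succAbove_right_injective]
      simp
    · obtain ⟨i, hi⟩ := Fin.exists_succAbove_eq h
      rw [Matrix.det_eq_zero_of_row_eq_zero i, mul_zero]
      intro j
      rw [Matrix.submatrix_apply, hi, Matrix.one_apply_ne (Fin.succAbove_ne p j).symm]
  · intro s _ hs
    simp [hs]
  · simp

/-- The left side is the Laplace expansion of the determinant with first column `y ∘ a` and
remaining columns `A(a, b)`. That matrix factors as the row selection `a`, times `A`, times the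
matrix with columns `A⁻¹ y` and the basis vectors `e_b`; multiplicativity of the determinant and
`adj A = det A · A⁻¹` give the right side. -/
theorem sum_minor_succAbove {m : ℕ} {A : Matrix (Fin (m + 1)) (Fin (m + 1)) ℂ}
    (hA : IsUnit A.det) (a : Fin (m + 1) → Fin (m + 1)) (b : Fin m → Fin (m + 1))
    (y : Fin (m + 1) → ℂ) :
    ∑ s : Fin (m + 1), (-1) ^ (s : ℕ) * y (a s) * minor A (s.removeNth a) b =
      (rowSelect a).det * ∑ q, A.adjugate.mulVec y q * contractVol b q := by
  have h1 : A * consCol (A⁻¹.mulVec y) (rowSelect b).transpose =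
      consCol y (A.submatrix id b) := by
    rw [mul_consCol, Matrix.mulVec_mulVec, Matrix.mul_nonsing_inv _ hA, Matrix.one_mulVec]
    congr 1
    ext i j
    simp [rowSelect, Matrix.mul_apply, Matrix.one_apply]
  have h2 : rowSelect a * consCol y (A.submatrix id b) = consCol (y ∘ a) (A.submatrix a b) := by
    rw [rowSelect_mul]
    rfl
  have h3 := congrArg Matrix.det h2
  rw [det_consCol, Matrix.det_mul, ← h1, Matrix.det_mul, det_consCol_rowSelect] at h3
  have h4 : ∀ q, A.adjugate.mulVec y q = A.det * A⁻¹.mulVec y q := fun q => by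
    rw [Matrix.inv_def, Matrix.smul_mulVec, Pi.smul_apply, smul_eq_mul, ← mul_assoc,
      Ring.mul_inverse_cancel _ hA, one_mul]
  simp only [h4, mul_assoc, ← Finset.mul_sum]
  simp only [Finset.mul_sum] at h3 ⊢
  rw [h3]
  exact Finset.sum_congr rfl fun s _ => by
    simp only [minor, Matrix.submatrix_submatrix, Function.comp_apply, mul_assoc]
    rfl

/-! ### Exterior derivatives of the powers of the fundamental form -/

theorem minor_transpose {k : ℕ} (A : Matrix (Fin n) (Fin n) ℂ) (a b : Fin k → Fin n) :
    minor A.transpose a b = minor A b a := by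
  rw [minor, ← Matrix.transpose_submatrix, Matrix.det_transpose]
  rfl

/-- Take `y = e_k` in `sum_minor_succAbove`, differentiate in the direction `D k`, and sum over `k`.
Allowing any family `D` covers `∂` and `∂̄` together. -/
theorem sum_frameDeriv_minor {m : ℕ} {U : Set (Cn (m + 1))} (hU : IsOpen U)
    {F : Cn (m + 1) → Matrix (Fin (m + 1)) (Fin (m + 1)) ℂ}
    (hF : ∀ i j, ContDiffOn ℝ ∞ (fun w => F w i j) U) (hdet : ∀ w ∈ U, IsUnit (F w).det)
    {z : Cn (m + 1)} (hz : z ∈ U) (D : Fin (m + 1) → Ix (m + 1)) (a : Fin (m + 1) → Fin (m + 1))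
    (b : Fin m → Fin (m + 1)) :
    ∑ s : Fin (m + 1), (-1) ^ (s : ℕ) *
      frameDeriv (D (a s)) (fun w => minor (F w) (s.removeNth a) b) z =
      (rowSelect a).det * ∑ q, contractVol b q *
        ∑ k, frameDeriv (D k) (fun w => (F w).adjugate q k) z := by
  have hM : ∀ s : Fin (m + 1),
      DifferentiableAt ℝ (fun w => minor (F w) (s.removeNth a) b) z := fun s =>
    differentiableAt_of_contDiffOn hU hz
      (contDiffOn_det (H := fun w => (F w).submatrix (s.removeNth a) b) fun i j => hF _ _)
  have hA : ∀ q k, DifferentiableAt ℝ (fun w => (F w).adjugate q k) z := fun q k =>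
    differentiableAt_of_contDiffOn hU hz (contDiffOn_adjugate hF q k)
  have h1 : ∀ k, ∑ s : Fin (m + 1), (-1) ^ (s : ℕ) * (if a s = k then 1 else 0) *
      frameDeriv (D k) (fun w => minor (F w) (s.removeNth a) b) z =
      (rowSelect a).det * ∑ q, contractVol b q *
        frameDeriv (D k) (fun w => (F w).adjugate q k) z := fun k => by
    have h2 : (fun w => ∑ s : Fin (m + 1), ((-1) ^ (s : ℕ) * (if a s = k then 1 else 0) : ℂ) *
        minor (F w) (s.removeNth a) b) =ᶠ[𝓝 z]
        fun w => (rowSelect a).det * ∑ q, contractVol b q * (F w).adjugate q k := by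
      filter_upwards [hU.mem_nhds hz] with w hw
      have h3 := sum_minor_succAbove (hdet w hw) a b (Pi.single k 1)
      simp only [Matrix.mulVec_single_one, Pi.single_apply, Matrix.col_apply] at h3
      rw [h3]
      simp only [mul_comm]
    have h4 := frameDeriv_congr (A := D k) h2
    rw [frameDeriv_sum _ fun s _ => (hM s).const_mul _,
      frameDeriv_const_mul _ (DifferentiableAt.fun_sum fun q _ => (hA q k).const_mul _),
      frameDeriv_sum _ fun q _ => (hA q k).const_mul _] at h4
    simpa only [frameDeriv_const_mul _ (hM _), frameDeriv_const_mul _ (hA _ k)] using h4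
  have h5 : (rowSelect a).det * ∑ q, contractVol b q *
      ∑ k, frameDeriv (D k) (fun w => (F w).adjugate q k) z =
      ∑ k, (rowSelect a).det * ∑ q, contractVol b q *
        frameDeriv (D k) (fun w => (F w).adjugate q k) z := by
    rw [← Finset.mul_sum, Finset.sum_comm]
    congr 1
    exact Finset.sum_congr rfl fun q _ => Finset.mul_sum _ _ _
  rw [h5, ← Finset.sum_congr rfl fun k _ => h1 k, Finset.sum_comm]
  refine Finset.sum_congr rfl fun s _ => ?_
  rw [Finset.sum_eq_single (a s)]
  · simp
  · intro k _ hk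
    simp [hk.symm]
  · simp

namespace IsLocalMetric

section Powers

variable {m : ℕ} {U : Set (Cn (m + 1))} {H : Cn (m + 1) → Matrix (Fin (m + 1)) (Fin (m + 1)) ℂ}

theorem conj_adjugate (hH : IsLocalMetric U H) (w : Cn (m + 1)) (i j : Fin (m + 1)) :
    conj ((H w).adjugate i j) = (H w).adjugate j i := by
  have h := Matrix.adjugate_conjTranspose (H w)
  rw [(hH.herm w).eq] at h
  conv_rhs => rw [← h]
  rfl

theorem exists_del_delbar_fundFormPow (hH : IsLocalMetric U H) : ∃ c : ℂ, c ≠ 0 ∧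
    (∀ z ∈ U, ∀ a b, (fundFormPow H m).del z a b = c * ((rowSelect a).det *
      ∑ q, contractVol b q * ∑ k, dz k (fun w => (H w).adjugate q k) z)) ∧
    ∀ z ∈ U, ∀ a b, (fundFormPow H m).delbar z a b = (-1) ^ m * c * ((rowSelect b).det *
      ∑ q, contractVol a q * conj (∑ k, dz k (fun w => (H w).adjugate q k) z)) := by
  obtain ⟨c, hc, hp⟩ := exists_fundFormPow_eq (n := m + 1) m
  have hM : ∀ z ∈ U, ∀ a b : Fin m → Fin (m + 1),
      DifferentiableAt ℝ (fun w => minor (H w) a b) z := fun z hz a b =>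
    hH.differentiableAt hz (contDiffOn_det (H := fun w => (H w).submatrix a b)
      fun i j => hH.smooth _ _)
  refine ⟨c, hc, fun z hz a b => ?_, fun z hz a b => ?_⟩
  · have h := sum_frameDeriv_minor hH.isOpen hH.smooth (fun w hw => hH.isUnit_det hw) hz Sum.inl a b
    simp only [frameDeriv] at h
    rw [← h, PQForm.del, Finset.mul_sum]
    refine Finset.sum_congr rfl fun s _ => ?_
    simp only [hp]
    rw [dz_const_mul _ _ (hM z hz _ _)]
    ring
  -- For `∂̄` the differentiated index is a column index, so the row version is applied to the
  -- transpose; Hermitian symmetry then turns the result into conjugates of the `∂` divergence.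
  · have h := sum_frameDeriv_minor (F := fun w => (H w).transpose) hH.isOpen
      (fun i j => hH.smooth j i)
      (fun w hw => by rw [Matrix.det_transpose]; exact hH.isUnit_det hw) hz Sum.inr b a
    simp only [frameDeriv, minor_transpose, ← Matrix.adjugate_transpose,
      Matrix.transpose_apply] at h
    simp only [map_sum, ← dzbar_conj, hH.conj_adjugate]
    rw [← h, PQForm.delbar, mul_assoc, Finset.mul_sum (a := c)]
    congr 1
    refine Finset.sum_congr rfl fun s _ => ?_
    simp only [hp]
    rw [dzbar_const_mul _ _ (hM z hz _ _)]
    ring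

theorem rowSelect_id_det : (rowSelect (id : Fin (m + 1) → Fin (m + 1))).det = 1 := by
  simp [rowSelect]

theorem sum_contractVol_succAbove_mul (p : Fin (m + 1)) (v : Fin (m + 1) → ℂ) :
    ∑ q, contractVol p.succAbove q * v q = (-1) ^ (p : ℕ) * v p := by
  simp [contractVol_succAbove]

theorem isGauduchonAt (hH : IsLocalMetric U H)
    (hG : ∀ z ∈ U, ∀ a b, (fundFormPow H m).delbar.del z a b = 0) {z : Cn (m + 1)} (hz : z ∈ U) :
    IsGauduchonAt H z := by
  obtain ⟨c, hc, -, hb⟩ := hH.exists_del_delbar_fundFormPow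
  have hd : ∀ s, DifferentiableAt ℝ
      (fun w => conj (∑ k, dz k (fun v => (H v).adjugate s k) w)) z := fun s =>
    hH.differentiableAt hz (contDiffOn_conj (ContDiffOn.sum fun k _ =>
      contDiffOn_frameDeriv (A := Sum.inl k) hH.isOpen (hH.smooth_adjugate s k)))
  -- An `(n,n)`-form has a single independent component. Removing `s` from `id` gives `s.succAbove`,
  -- whose sign `(-1)^s` cancels the sign in `∂`.
  have h := hG z hz id id
  have h1 : (fundFormPow H m).delbar.del z id id = (-1) ^ m * c *
      ∑ s, dz s (fun w => conj (∑ k, dz k (fun v => (H v).adjugate s k) w)) z := by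
    rw [PQForm.del, Finset.mul_sum]
    refine Finset.sum_congr rfl fun s _ => ?_
    rw [dz_congr (id s) (g := fun w => (-1) ^ m * c * (-1) ^ (s : ℕ) *
      conj (∑ k, dz k (fun v => (H v).adjugate s k) w)), dz_const_mul _ _ (hd s)]
    · have h2 : ((-1 : ℂ) ^ (s : ℕ)) * (-1) ^ (s : ℕ) = 1 := by
        rw [← mul_pow]; simp
      simp only [id]
      linear_combination (-1) ^ m * c *
        dz s (fun w => conj (∑ k, dz k (fun v => (H v).adjugate s k) w)) z * h2
    · filter_upwards [hH.eventually_mem hz] with w hw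
      have h3 : s.removeNth (id : Fin (m + 1) → Fin (m + 1)) = s.succAbove := rfl
      rw [hb w hw, h3, rowSelect_id_det, sum_contractVol_succAbove_mul]
      ring
  rw [h1] at h
  exact (mul_eq_zero.mp h).resolve_left (by simp [hc])

/-- Testing on the lists `p.succAbove` extracts every entry of `h⁻¹ τ`, and `h⁻¹` is invertible. The
`∂` component alone already forces `τ = 0`. -/
theorem isClosedAt_fundFormPow_iff (hH : IsLocalMetric U H) {z : Cn (m + 1)} (hz : z ∈ U) :
    (fundFormPow H m).IsClosedAt z ↔ ∀ i, torsionTrace H z i = 0 := by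
  obtain ⟨c, hc, ha, hb⟩ := hH.exists_del_delbar_fundFormPow
  simp only [PQForm.IsClosedAt, ha z hz, hb z hz, hH.sum_dz_adjugate hz]
  constructor
  · rintro ⟨h, -⟩
    have h1 : ((H z)⁻¹).mulVec (torsionTrace H z) = 0 := by
      ext p
      have := h id p.succAbove
      rw [rowSelect_id_det, sum_contractVol_succAbove_mul] at this
      have h2 : ∑ k, (H z)⁻¹ p k * torsionTrace H z k = 0 := by
        simpa [hc, hH.det_ne_zero hz] using this
      exact h2
    have h2 := congrArg (H z).mulVec h1
    rw [Matrix.mulVec_mulVec, Matrix.mul_nonsing_inv _ (hH.isUnit_det hz), Matrix.one_mulVec,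
      Matrix.mulVec_zero] at h2
    exact congrFun h2
  · intro h
    simp [h]

end Powers

variable {U : Set (Cn n)} {H : Cn n → Matrix (Fin n) (Fin n) ℂ} {z : Cn n}

theorem sum_chernTorsion_mul (hH : IsLocalMetric U H) (hz : z ∈ U) (i k q : Fin n) :
    ∑ l, chernTorsion H z i k l * H z l q =
      dz i (fun w => H w k q) z - dz k (fun w => H w i q) z := by
  simp only [chernTorsion, sub_mul, Finset.sum_sub_distrib, chernCoeff_lower (hH.isUnit_det hz)]

theorem isClosedAt_fundForm (hH : IsLocalMetric U H) (hz : z ∈ U)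
    (hT : ∀ i k l, chernTorsion H z i k l = 0) : (fundForm H).IsClosedAt z := by
  have h1 : ∀ i k q, dz i (fun w => H w k q) z = dz k (fun w => H w i q) z := fun i k q => by
    rw [← sub_eq_zero, ← hH.sum_chernTorsion_mul hz]
    simp [hT]
  have hd : ∀ i j, DifferentiableAt ℝ (fun w => H w i j) z := fun i j =>
    hH.differentiableAt hz (hH.smooth i j)
  constructor
  · intro a b
    simp only [PQForm.del, fundForm, dz_const_mul _ _ (hd _ _)]
    rw [Fin.sum_univ_two, h1]
    simp [Fin.removeNth]
  · intro a b
    simp only [PQForm.delbar, fundForm, dzbar_const_mul _ _ (hd _ _), dzbar_H hH.herm]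
    rw [Fin.sum_univ_two, h1]
    simp [Fin.removeNth]

end IsLocalMetric

/-! ### Positivity of the norms of the torsion -/

namespace IsLocalMetric

variable {U : Set (Cn n)} {H : Cn n → Matrix (Fin n) (Fin n) ℂ} {z : Cn n}

theorem torsionTraceNormSq_eq (H : Cn n → Matrix (Fin n) (Fin n) ℂ) (z : Cn n) :
    torsionTraceNormSq H z =
      dotProduct (star (torsionTrace H z)) (((H z)⁻¹).mulVec (torsionTrace H z)) := by
  simp only [torsionTraceNormSq, dotProduct, Matrix.mulVec, Finset.mul_sum]
  rw [Finset.sum_comm]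
  refine Finset.sum_congr rfl fun j _ => Finset.sum_congr rfl fun i _ => ?_
  rw [Pi.star_apply, Complex.star_def]
  ring

theorem torsionTraceNormSq_nonneg (hH : IsLocalMetric U H) (hz : z ∈ U) :
    0 ≤ (torsionTraceNormSq H z).re := by
  rw [torsionTraceNormSq_eq]
  exact (Complex.le_def.mp ((hH.pos z hz).inv.posSemidef.dotProduct_mulVec_nonneg _)).1

theorem torsionTrace_eq_zero (hH : IsLocalMetric U H) (hz : z ∈ U)
    (h : (torsionTraceNormSq H z).re = 0) (i : Fin n) : torsionTrace H z i = 0 := by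
  by_contra hi
  have hne : torsionTrace H z ≠ 0 := fun h0 => hi (congrFun h0 i)
  have := (Complex.lt_def.mp ((hH.pos z hz).inv.dotProduct_mulVec_pos hne)).1
  rw [← torsionTraceNormSq_eq, h] at this
  exact lt_irrefl _ this

open scoped Kronecker in
-- Exhibits `|T|²` as the quadratic form of `h⁻¹ ⊗ h⁻¹ ⊗ hᵀ`, so that nonnegativity and definiteness
-- follow from positivity of Kronecker products.
theorem torsionNormSq_eq (H : Cn n → Matrix (Fin n) (Fin n) ℂ) (z : Cn n) :
    torsionNormSq H z =
      dotProduct (star fun p : Fin n × Fin n × Fin n => chernTorsion H z p.1 p.2.1 p.2.2)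
        (((H z)⁻¹ ⊗ₖ ((H z)⁻¹ ⊗ₖ (H z).transpose)).mulVec
          fun p : Fin n × Fin n × Fin n => chernTorsion H z p.1 p.2.1 p.2.2) := by
  simp only [torsionNormSq, dotProduct, Matrix.mulVec, Finset.mul_sum, Fintype.sum_prod_type,
    Matrix.kroneckerMap_apply, Pi.star_apply, Complex.star_def, Matrix.transpose_apply]
  calc _ = ∑ i, ∑ q, ∑ j, ∑ k, ∑ f, ∑ r, (H z)⁻¹ q i * (H z)⁻¹ j k * H z f r *
        (chernTorsion H z i k f * conj (chernTorsion H z q j r)) :=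
        Finset.sum_congr rfl fun i _ => Finset.sum_congr rfl fun q _ => Finset.sum_comm
    _ = ∑ q, ∑ i, ∑ j, ∑ k, ∑ f, ∑ r, (H z)⁻¹ q i * (H z)⁻¹ j k * H z f r *
        (chernTorsion H z i k f * conj (chernTorsion H z q j r)) := Finset.sum_comm
    _ = ∑ q, ∑ j, ∑ i, ∑ k, ∑ f, ∑ r, (H z)⁻¹ q i * (H z)⁻¹ j k * H z f r *
        (chernTorsion H z i k f * conj (chernTorsion H z q j r)) :=
        Finset.sum_congr rfl fun q _ => Finset.sum_comm
    _ = ∑ q, ∑ j, ∑ i, ∑ k, ∑ r, ∑ f, (H z)⁻¹ q i * (H z)⁻¹ j k * H z f r *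
        (chernTorsion H z i k f * conj (chernTorsion H z q j r)) :=
        Finset.sum_congr rfl fun q _ => Finset.sum_congr rfl fun j _ =>
          Finset.sum_congr rfl fun i _ => Finset.sum_congr rfl fun k _ => Finset.sum_comm
    _ = ∑ q, ∑ j, ∑ i, ∑ r, ∑ k, ∑ f, (H z)⁻¹ q i * (H z)⁻¹ j k * H z f r *
        (chernTorsion H z i k f * conj (chernTorsion H z q j r)) :=
        Finset.sum_congr rfl fun q _ => Finset.sum_congr rfl fun j _ =>
          Finset.sum_congr rfl fun i _ => Finset.sum_comm
    _ = ∑ q, ∑ j, ∑ r, ∑ i, ∑ k, ∑ f, (H z)⁻¹ q i * (H z)⁻¹ j k * H z f r *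
        (chernTorsion H z i k f * conj (chernTorsion H z q j r)) :=
        Finset.sum_congr rfl fun q _ => Finset.sum_congr rfl fun j _ => Finset.sum_comm
    _ = _ := by
        refine Finset.sum_congr rfl fun q _ => Finset.sum_congr rfl fun j _ =>
          Finset.sum_congr rfl fun r _ => Finset.sum_congr rfl fun i _ =>
          Finset.sum_congr rfl fun k _ => Finset.sum_congr rfl fun f _ => ?_
        ring

theorem torsionNormSq_nonneg (hH : IsLocalMetric U H) (hz : z ∈ U) :
    0 ≤ (torsionNormSq H z).re := by
  have hp := (hH.pos z hz).inv.kronecker ((hH.pos z hz).inv.kronecker (hH.pos z hz).transpose)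
  rw [torsionNormSq_eq]
  exact (Complex.le_def.mp (hp.posSemidef.dotProduct_mulVec_nonneg _)).1

theorem chernTorsion_eq_zero (hH : IsLocalMetric U H) (hz : z ∈ U)
    (h : (torsionNormSq H z).re = 0) (i k l : Fin n) : chernTorsion H z i k l = 0 := by
  by_contra hi
  have hne : (fun p : Fin n × Fin n × Fin n => chernTorsion H z p.1 p.2.1 p.2.2) ≠ 0 :=
    fun h0 => hi (congrFun h0 (i, k, l))
  have hp := (hH.pos z hz).inv.kronecker ((hH.pos z hz).inv.kronecker (hH.pos z hz).transpose)
  have := (Complex.lt_def.mp (hp.dotProduct_mulVec_pos hne)).1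
  rw [← torsionNormSq_eq, h] at this
  exact lt_irrefl _ this

/-- In dimension two the torsion is determined by `T_{01}^l`, with `τ_0 = T_{01}^1` and `τ_1 =
-T_{01}^0`. Antisymmetry turns the two inverse metrics into `2 det(h⁻¹)`, and `det(h⁻¹) h =
adj(h⁻¹)` is the same pairing as `h⁻¹` on `τ`. -/
theorem torsionNormSq_eq_two_mul {U : Set (Cn 2)} {H : Cn 2 → Matrix (Fin 2) (Fin 2) ℂ} {z : Cn 2}
    (hH : IsLocalMetric U H) (hz : z ∈ U) : torsionNormSq H z = 2 * torsionTraceNormSq H z := by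
  have h1 : (H z)⁻¹.det • H z = (H z)⁻¹.adjugate := by
    calc _ = (H z)⁻¹.adjugate * ((H z)⁻¹ * H z) := by
          rw [← Matrix.mul_assoc, Matrix.adjugate_mul, Matrix.smul_mul, Matrix.one_mul]
      _ = _ := by rw [Matrix.nonsing_inv_mul _ (hH.isUnit_det hz), Matrix.mul_one]
  rw [Matrix.det_fin_two, Matrix.adjugate_fin_two] at h1
  have h00 := congrFun (congrFun h1 0) 0
  have h01 := congrFun (congrFun h1 0) 1
  have h10 := congrFun (congrFun h1 1) 0
  have h11 := congrFun (congrFun h1 1) 1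
  simp only [Matrix.smul_apply, smul_eq_mul, Matrix.of_apply, Matrix.cons_val', Matrix.cons_val_zero,
    Matrix.cons_val_one, Matrix.cons_val_fin_one] at h00 h01 h10 h11
  have hd : ∀ i l, chernTorsion H z i i l = 0 := fun i l => by simp [chernTorsion]
  have hs : ∀ l, chernTorsion H z 1 0 l = -chernTorsion H z 0 1 l := fun l =>
    chernTorsion_swap H z 0 1 l
  simp only [torsionNormSq, torsionTraceNormSq, torsionTrace, Fin.sum_univ_two, hd, hs, map_zero,
    map_neg, map_add, mul_zero, zero_mul, add_zero, zero_add]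
  linear_combination
    2 * chernTorsion H z 0 1 0 * conj (chernTorsion H z 0 1 0) * h00 +
    2 * chernTorsion H z 0 1 0 * conj (chernTorsion H z 0 1 1) * h01 +
    2 * chernTorsion H z 0 1 1 * conj (chernTorsion H z 0 1 0) * h10 +
    2 * chernTorsion H z 0 1 1 * conj (chernTorsion H z 0 1 1) * h11

end IsLocalMetric

/-! ### Holomorphic changes of coordinates -/

section Holomorphic

variable {f : Cn n → ℂ} {z : Cn n}

theorem single_I (i : Fin n) : (Pi.single i Complex.I : Cn n) = Complex.I • Pi.single i (1 : ℂ) := by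
  rw [← Pi.single_smul, smul_eq_mul, mul_one]

theorem dz_of_differentiableAt (i : Fin n) (hf : DifferentiableAt ℂ f z) :
    dz i f z = fderiv ℂ f z (Pi.single i 1) := by
  rw [dz, hf.fderiv_restrictScalars ℝ]
  simp only [ContinuousLinearMap.coe_restrictScalars', single_I, map_smul, smul_eq_mul,
    ← mul_assoc, Complex.I_mul_I]
  ring

theorem dzbar_of_differentiableAt (i : Fin n) (hf : DifferentiableAt ℂ f z) :
    dzbar i f z = 0 := by
  rw [dzbar, hf.fderiv_restrictScalars ℝ]
  simp only [ContinuousLinearMap.coe_restrictScalars', single_I, map_smul, smul_eq_mul,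
    ← mul_assoc, Complex.I_mul_I]
  ring

theorem fderiv_apply_eq (f : Cn n → ℂ) (y c : Cn n) :
    fderiv ℝ f y c = ∑ a, (c a * dz a f y + conj (c a) * dzbar a f y) := by
  have hc : c = ∑ a, ((c a).re • (Pi.single a 1 : Cn n) + (c a).im • (Pi.single a Complex.I : Cn n)) := by
    funext b
    simp only [Finset.sum_apply, Pi.add_apply, Pi.smul_apply, Pi.single_apply]
    rw [Finset.sum_eq_single b]
    · simp [Complex.re_add_im]
    · intro a _ ha
      simp [ha.symm]
    · simp
  conv_lhs => rw [hc]
  rw [map_sum]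
  refine Finset.sum_congr rfl fun a _ => ?_
  have h1 : c a = (c a).re + (c a).im * Complex.I := (Complex.re_add_im _).symm
  have h2 : conj (c a) = (c a).re - (c a).im * Complex.I :=
    Complex.ext (by simp) (by simp)
  rw [h2, map_add, map_smul, map_smul, Complex.real_smul, Complex.real_smul, dz, dzbar]
  conv_rhs => rw [h1]
  simp only [Complex.add_re, Complex.ofReal_re, Complex.mul_re, Complex.I_re, mul_zero,
    Complex.ofReal_im, Complex.I_im, mul_one, sub_self, add_zero, Complex.add_im, Complex.mul_im,
    zero_add]
  linear_combination (((c a).im : ℂ) * fderiv ℝ f y (Pi.single a Complex.I)) * Complex.I_sq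

/-- The complex Jacobian matrix `∂φᵏ/∂zⁱ`. -/
def jac (φ : Cn n → Cn n) (z : Cn n) (k i : Fin n) : ℂ :=
  fderiv ℂ φ z (Pi.single i 1) k

theorem dz_comp {φ : Cn n → Cn n} (i : Fin n) (hφ : DifferentiableAt ℂ φ z)
    (hf : DifferentiableAt ℝ f (φ z)) :
    dz i (fun w => f (φ w)) z = ∑ a, jac φ z a i * dz a f (φ z) := by
  have h := (hf.hasFDerivAt.comp z (hφ.hasFDerivAt.restrictScalars ℝ)).fderiv
  have h' : fderiv ℝ (fun w => f (φ w)) z = (fderiv ℝ f (φ z)).comp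
      ((fderiv ℂ φ z).restrictScalars ℝ) := h
  rw [dz, h']
  simp only [ContinuousLinearMap.comp_apply, ContinuousLinearMap.coe_restrictScalars', single_I,
    map_smul, fderiv_apply_eq, Pi.smul_apply, smul_eq_mul, map_mul, Complex.conj_I]
  rw [Finset.mul_sum, ← Finset.sum_sub_distrib, Finset.sum_div]
  refine Finset.sum_congr rfl fun a _ => ?_
  rw [jac]
  linear_combination (-(fderiv ℂ φ z (Pi.single i 1) a) * dz a f (φ z) / 2 +
    conj (fderiv ℂ φ z (Pi.single i 1) a) * dzbar a f (φ z) / 2) * Complex.I_sq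

theorem differentiableAt_jac {φ : Cn n → Cn n} (hφ : ContDiffAt ℂ 2 φ z) (k i : Fin n) :
    DifferentiableAt ℂ (fun w => jac φ w k i) z := by
  have h1 : DifferentiableAt ℂ (fderiv ℂ φ) z :=
    (hφ.fderiv_right (m := 1) (by norm_num)).differentiableAt (by norm_num)
  exact differentiableAt_pi.mp (h1.clm_apply (differentiableAt_const _)) k

theorem dz_jac_comm {φ : Cn n → Cn n} (hφ : ContDiffAt ℂ 2 φ z) (i j k : Fin n) :
    dz i (fun w => jac φ w k j) z = dz j (fun w => jac φ w k i) z := by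
  have h1 : DifferentiableAt ℂ (fderiv ℂ φ) z :=
    (hφ.fderiv_right (m := 1) (by norm_num)).differentiableAt (by norm_num)
  have h2 : ∀ a b : Fin n, fderiv ℂ (fun w => jac φ w k a) z (Pi.single b 1) =
      fderiv ℂ (fderiv ℂ φ) z (Pi.single b 1) (Pi.single a 1) k := fun a b => by
    have h3 : HasFDerivAt (fun w => fderiv ℂ φ w (Pi.single a 1))
        ((fderiv ℂ (fderiv ℂ φ) z).flip (Pi.single a 1)) z := by
      have := h1.hasFDerivAt.clm_apply (hasFDerivAt_const (Pi.single a (1 : ℂ) : Cn n) z)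
      simpa using this
    have h4 := (hasFDerivAt_pi'.mp h3 k).fderiv
    have h5 : fderiv ℂ (fun w => jac φ w k a) z = (ContinuousLinearMap.proj k).comp
      ((fderiv ℂ (fderiv ℂ φ) z).flip (Pi.single a 1)) := h4
    rw [h5]
    rfl
  rw [dz_of_differentiableAt i (differentiableAt_jac hφ k j),
    dz_of_differentiableAt j (differentiableAt_jac hφ k i), h2, h2,
    (hφ.isSymmSndFDerivAt (by simp)).eq]

end Holomorphic

/-! ### Tensoriality of the torsion and its trace -/

section Transformation

variable {U U' : Set (Cn n)} {H H' : Cn n → Matrix (Fin n) (Fin n) ℂ} {φ : Cn n → Cn n} {z : Cn n}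

/-- `H` is the pull-back of `H'` by the holomorphic map `φ` near `z`. -/
structure IsPullbackAt (H H' : Cn n → Matrix (Fin n) (Fin n) ℂ) (φ : Cn n → Cn n) (z : Cn n) :
    Prop where
  contDiffAt : ContDiffAt ℂ 2 φ z
  eq : ∀ᶠ w in 𝓝 z, ∀ i j, H w i j =
    ∑ k, ∑ l, jac φ w k i * conj (jac φ w l j) * H' (φ w) k l

/-- Derivatives of the Jacobian are symmetric in `i, j` and drop out after antisymmetrization;
conjugate Jacobians are killed by `∂_i`. Only the chain-rule terms survive, and these transform as a
tensor. -/
theorem IsPullbackAt.dz_sub (hp : IsPullbackAt H H' φ z) (hH' : IsLocalMetric U' H')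
    (hz' : φ z ∈ U') (i j q : Fin n) :
    dz i (fun w => H w j q) z - dz j (fun w => H w i q) z =
      ∑ k, ∑ l, ∑ a, jac φ z k j * conj (jac φ z l q) * jac φ z a i *
        (dz a (fun w => H' w k l) (φ z) - dz k (fun w => H' w a l) (φ z)) := by
  have hφ : DifferentiableAt ℂ φ z := hp.contDiffAt.differentiableAt (by norm_num)
  have hJ : ∀ k i, DifferentiableAt ℝ (fun w => jac φ w k i) z := fun k i =>
    (differentiableAt_jac hp.contDiffAt k i).restrictScalars ℝ
  have hJc : ∀ k i, DifferentiableAt ℝ (fun w => conj (jac φ w k i)) z := fun k i =>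
    Complex.conjCLE.differentiableAt.comp z (hJ k i)
  have hd : ∀ k l, DifferentiableAt ℝ (fun w => H' w k l) (φ z) := fun k l =>
    hH'.differentiableAt hz' (hH'.smooth k l)
  have hdc : ∀ k l, DifferentiableAt ℝ (fun w => H' (φ w) k l) z := fun k l =>
    (hd k l).comp z (hφ.restrictScalars ℝ)
  have h1 : ∀ i j, dz i (fun w => H w j q) z = ∑ k, ∑ l,
      (dz i (fun w => jac φ w k j) z * conj (jac φ z l q) * H' (φ z) k l +
        ∑ a, jac φ z k j * conj (jac φ z l q) * jac φ z a i * dz a (fun w => H' w k l) (φ z)) :=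
      fun i j => by
    rw [dz_congr i (g := fun w => ∑ k, ∑ l, jac φ w k j * conj (jac φ w l q) * H' (φ w) k l)
      (by filter_upwards [hp.eq] with w hw using hw j q),
      dz_sum i _ (f := fun k w => ∑ l, jac φ w k j * conj (jac φ w l q) * H' (φ w) k l)
      fun k _ => DifferentiableAt.fun_sum fun l _ => ((hJ k j).mul (hJc l q)).mul (hdc k l)]
    refine Finset.sum_congr rfl fun k _ => ?_
    rw [dz_sum i _ (f := fun l w => jac φ w k j * conj (jac φ w l q) * H' (φ w) k l)
      fun l _ => ((hJ k j).mul (hJc l q)).mul (hdc k l)]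
    refine Finset.sum_congr rfl fun l _ => ?_
    rw [dz_mul i (f := fun w => jac φ w k j * conj (jac φ w l q)) (g := fun w => H' (φ w) k l)
      ((hJ k j).mul (hJc l q)) (hdc k l), dz_mul i (hJ k j) (hJc l q), dz_conj,
      dzbar_of_differentiableAt i (differentiableAt_jac hp.contDiffAt l q),
      dz_comp (f := fun y => H' y k l) i hφ (hd k l), Finset.mul_sum, map_zero, mul_zero, add_zero]
    congr 1
    exact Finset.sum_congr rfl fun a _ => by ring
  -- Exchanges the names of `a` and `k`, so that the antisymmetrization falls on the derivatives of
  -- `H'`.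
  have h2 : ∀ i j, ∑ k, ∑ l, ∑ a,
      jac φ z k i * conj (jac φ z l q) * jac φ z a j * dz a (fun w => H' w k l) (φ z) =
      ∑ k, ∑ l, ∑ a,
      jac φ z k j * conj (jac φ z l q) * jac φ z a i * dz k (fun w => H' w a l) (φ z) :=
      fun i j => by
    calc _ = ∑ l, ∑ k, ∑ a,
          jac φ z k i * conj (jac φ z l q) * jac φ z a j * dz a (fun w => H' w k l) (φ z) :=
          Finset.sum_comm
      _ = ∑ l, ∑ a, ∑ k,
          jac φ z k i * conj (jac φ z l q) * jac φ z a j * dz a (fun w => H' w k l) (φ z) :=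
          Finset.sum_congr rfl fun l _ => Finset.sum_comm
      _ = ∑ a, ∑ l, ∑ k,
          jac φ z k i * conj (jac φ z l q) * jac φ z a j * dz a (fun w => H' w k l) (φ z) :=
          Finset.sum_comm
      _ = _ := Finset.sum_congr rfl fun a _ => Finset.sum_congr rfl fun l _ =>
          Finset.sum_congr rfl fun k _ => by ring
  simp only [h1, Finset.sum_add_distrib, dz_jac_comm hp.contDiffAt i j, mul_sub,
    Finset.sum_sub_distrib, ← h2]
  ring

theorem IsPullbackAt.chernTorsion_eq_zero (hp : IsPullbackAt H H' φ z) (hH : IsLocalMetric U H)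
    (hz : z ∈ U) (hH' : IsLocalMetric U' H') (hz' : φ z ∈ U')
    (hT : ∀ i k l, chernTorsion H' (φ z) i k l = 0) (i k l : Fin n) :
    chernTorsion H z i k l = 0 := by
  have h1 : ∀ a b q, dz a (fun w => H' w b q) (φ z) - dz b (fun w => H' w a q) (φ z) = 0 :=
    fun a b q => by
      rw [← hH'.sum_chernTorsion_mul hz']
      simp [hT]
  refine congrFun (lower_injective (a := fun l => chernTorsion H z i k l) (b := fun _ => 0)
    (hH.isUnit_det hz) fun q => ?_) l
  rw [hH.sum_chernTorsion_mul hz, hp.dz_sub hH' hz']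
  simp [h1]

theorem IsLocalMetric.torsionTrace_eq (hH : IsLocalMetric U H) (hz : z ∈ U) (i : Fin n) :
    torsionTrace H z i =
      ∑ j, ∑ q, (H z)⁻¹ q j * (dz i (fun w => H w j q) z - dz j (fun w => H w i q) z) := by
  refine Finset.sum_congr rfl fun j _ => ?_
  simp only [← hH.sum_chernTorsion_mul hz, Finset.mul_sum]
  rw [Finset.sum_comm]
  have h : ∀ l, ∑ q, (H z)⁻¹ q j * (chernTorsion H z i j l * H z l q) =
      chernTorsion H z i j l * if l = j then 1 else 0 := fun l => by
    rw [← hH.sum_mul_inv hz, Finset.mul_sum]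
    exact Finset.sum_congr rfl fun q _ => by ring
  simp [h]

theorem IsPullbackAt.torsionTrace_eq (hp : IsPullbackAt H H' φ z) (hH : IsLocalMetric U H)
    (hz : z ∈ U) (hH' : IsLocalMetric U' H') (hz' : φ z ∈ U') (i : Fin n) :
    torsionTrace H z i = ∑ a, jac φ z a i * torsionTrace H' (φ z) a := by
  let J : Matrix (Fin n) (Fin n) ℂ := Matrix.of (jac φ z)
  let C : Matrix (Fin n) (Fin n) ℂ := Matrix.of fun l q => conj (jac φ z l q)
  have hHJ : H z = J.transpose * H' (φ z) * C := by
    ext i j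
    rw [hp.eq.self_of_nhds i j]
    simp only [Matrix.mul_apply, Matrix.transpose_apply, Finset.sum_mul, J, C, Matrix.of_apply]
    rw [Finset.sum_comm]
    exact Finset.sum_congr rfl fun l _ => Finset.sum_congr rfl fun k _ => by ring
  -- Invertibility of the Jacobian is not assumed: it follows from `H = Jᵀ H' C` with `H`
  -- invertible, since a one-sided inverse of a square matrix is two-sided.
  have hG : C * (H z)⁻¹ * J.transpose = (H' (φ z))⁻¹ := by
    have h1 : ((H z)⁻¹ * J.transpose * H' (φ z)) * C = 1 := by
      have h0 := Matrix.nonsing_inv_mul _ (hH.isUnit_det hz)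
      rw [← h0]
      conv_rhs => arg 2; rw [hHJ]
      simp only [Matrix.mul_assoc]
    have h2 := mul_eq_one_comm.mp h1
    refine (Matrix.inv_eq_left_inv ?_).symm
    rw [← h2]
    simp only [Matrix.mul_assoc]
  have hG' : ∀ l k, (H' (φ z))⁻¹ l k =
      ∑ j, ∑ q, (H z)⁻¹ q j * (jac φ z k j * conj (jac φ z l q)) := fun l k => by
    rw [← hG]
    simp only [Matrix.mul_apply, Matrix.transpose_apply, Finset.sum_mul, J, C, Matrix.of_apply]
    exact Finset.sum_congr rfl fun j _ => Finset.sum_congr rfl fun q _ => by ring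
  simp only [hH.torsionTrace_eq hz, hH'.torsionTrace_eq hz', hp.dz_sub hH' hz', hG',
    Finset.mul_sum, Finset.sum_mul]
  set D := fun a k l => dz a (fun w => H' w k l) (φ z) - dz k (fun w => H' w a l) (φ z) with hD
  calc ∑ j, ∑ q, ∑ k, ∑ l, ∑ a, (H z)⁻¹ q j *
        (jac φ z k j * conj (jac φ z l q) * jac φ z a i * D a k l)
      = ∑ p : Fin n × Fin n, ∑ r : Fin n × Fin n × Fin n, (H z)⁻¹ p.2 p.1 *
        (jac φ z r.1 p.1 * conj (jac φ z r.2.1 p.2) * jac φ z r.2.2 i * D r.2.2 r.1 r.2.1) := by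
        simp only [Fintype.sum_prod_type]
    _ = ∑ r : Fin n × Fin n × Fin n, ∑ p : Fin n × Fin n, (H z)⁻¹ p.2 p.1 *
        (jac φ z r.1 p.1 * conj (jac φ z r.2.1 p.2) * jac φ z r.2.2 i * D r.2.2 r.1 r.2.1) :=
        Finset.sum_comm
    _ = ∑ k, ∑ l, ∑ a, ∑ j, ∑ q, (H z)⁻¹ q j *
        (jac φ z k j * conj (jac φ z l q) * jac φ z a i * D a k l) := by
        simp only [Fintype.sum_prod_type]
    _ = ∑ k, ∑ a, ∑ l, ∑ j, ∑ q, (H z)⁻¹ q j *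
        (jac φ z k j * conj (jac φ z l q) * jac φ z a i * D a k l) :=
        Finset.sum_congr rfl fun k _ => Finset.sum_comm
    _ = ∑ a, ∑ k, ∑ l, ∑ j, ∑ q, (H z)⁻¹ q j *
        (jac φ z k j * conj (jac φ z l q) * jac φ z a i * D a k l) := Finset.sum_comm
    _ = _ := Finset.sum_congr rfl fun a _ => Finset.sum_congr rfl fun k _ =>
        Finset.sum_congr rfl fun l _ => Finset.sum_congr rfl fun j _ =>
        Finset.sum_congr rfl fun q _ => by ring

end Transformation

/-! ### Hermitian metrics on complex manifolds -/

variable {M : Type*} [TopologicalSpace M] [ChartedSpace (Cn n) M]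

/-- The derivative of the inverse of the chart `e`, on the model space. -/
def chartDeriv (e : OpenPartialHomeomorph M (Cn n)) (z : Cn n) : Cn n →L[ℂ] Cn n :=
  mfderiv 𝓘(ℂ, Cn n) 𝓘(ℂ, Cn n) e.symm z

namespace HermitianMetric

/-- The Hermitian metric at `x` as a sesquilinear form on the model space. -/
def form (h : HermitianMetric n M) (x : M) : Cn n →ₗ[ℂ] Cn n →ₗ⋆[ℂ] ℂ := h.inner x

theorem coeff_eq (h : HermitianMetric n M) (e : OpenPartialHomeomorph M (Cn n)) (z : Cn n)
    (i j : Fin n) : h.coeff e z i j = h.form (e.symm z) (chartDeriv e z (Pi.single i 1))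
      (chartDeriv e z (Pi.single j 1)) := rfl

theorem form_conj_symm (h : HermitianMetric n M) (x : M) (u v : Cn n) :
    h.form x u v = conj (h.form x v u) := h.conj_symm x u v

theorem form_pos (h : HermitianMetric n M) (x : M) (u : Cn n) (hu : u ≠ 0) :
    0 < (h.form x u u).re := h.pos x u hu

theorem form_sum_sum (h : HermitianMetric n M) (x : M) (u v : Cn n) (L : Cn n →L[ℂ] Cn n) :
    h.form x (L u) (L v) = ∑ k, ∑ l, u k * conj (v l) *
      h.form x (L (Pi.single k 1)) (L (Pi.single l 1)) := by
  have hs : ∀ u : Cn n, L u = ∑ k, u k • L (Pi.single k 1) := fun u => by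
    conv_lhs => rw [pi_eq_sum_univ' u]
    simp only [map_sum, map_smul]
  rw [hs u, hs v]
  simp only [map_sum, LinearMap.sum_apply, map_smul, LinearMap.smul_apply, smul_eq_mul,
    map_smulₛₗ]
  simp only [Finset.mul_sum]
  rw [Finset.sum_comm]
  exact Finset.sum_congr rfl fun k _ => Finset.sum_congr rfl fun l _ => by ring

theorem isHermitian_coeff (h : HermitianMetric n M) (e : OpenPartialHomeomorph M (Cn n))
    (w : Cn n) : (h.coeff e w).IsHermitian := by
  ext i j
  rw [Matrix.conjTranspose_apply, coeff_eq, coeff_eq]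
  exact (form_conj_symm h _ _ _).symm

variable [IsManifold 𝓘(ℂ, Cn n) ω M] {e e' : OpenPartialHomeomorph M (Cn n)}

theorem isLocalMetric (h : HermitianMetric n M) (he : e ∈ atlas (Cn n) M) :
    IsLocalMetric e.target (h.coeff e) where
  isOpen := e.open_target
  herm := h.isHermitian_coeff e
  pos w hw := by
    have hm : IsManifold 𝓘(ℂ, Cn n) 1 M := IsManifold.of_le (n := ω) le_top
    have hinj : Function.Injective (chartDeriv e w) :=
      ((mdifferentiable_of_mem_atlas (I := 𝓘(ℂ, Cn n)) he).symm).mfderiv_injective hw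
    refine Matrix.PosDef.of_dotProduct_mulVec_pos (h.isHermitian_coeff e w) fun x hx => ?_
    -- The form is linear in its first slot, while `star x` occupies the first slot of the matrix
    -- pairing; hence the tangent vector has coordinates `star x`.
    have h1 : dotProduct (star x) ((h.coeff e w).mulVec x) =
        h.form (e.symm w) (chartDeriv e w (star x)) (chartDeriv e w (star x)) := by
      rw [form_sum_sum]
      simp only [dotProduct, Matrix.mulVec, Finset.mul_sum, coeff_eq, Pi.star_apply,
        Complex.star_def, Complex.conj_conj]
      exact Finset.sum_congr rfl fun k _ => Finset.sum_congr rfl fun l _ => by ring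
    have hne : chartDeriv e w (star x) ≠ 0 := fun h0 => hx (by
      have := hinj (h0.trans (map_zero _).symm)
      exact star_eq_zero.mp this)
    rw [h1, Complex.lt_def]
    refine ⟨h.form_pos _ _ hne, ?_⟩
    have := congrArg Complex.im (h.form_conj_symm (e.symm w) (chartDeriv e w (star x))
      (chartDeriv e w (star x)))
    rw [Complex.conj_im] at this
    rw [Complex.zero_im]
    linarith
  smooth i j := h.smooth e he i j

/-- The inverse chart `e.symm` factors locally through `e'.symm` and the transition map, so the
coordinate frames differ by its Jacobian. -/
theorem isPullbackAt (h : HermitianMetric n M) (he : e ∈ atlas (Cn n) M)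
    (he' : e' ∈ atlas (Cn n) M) {z : Cn n} (hz : z ∈ e.target) (hz' : e.symm z ∈ e'.source) :
    IsPullbackAt (h.coeff e) (h.coeff e') (fun w => e' (e.symm w)) z := by
  have hmem : ∀ᶠ w in 𝓝 z, w ∈ e.target ∧ e.symm w ∈ e'.source := by
    have h1 := (e.continuousAt_symm hz).preimage_mem_nhds (e'.open_source.mem_nhds hz')
    filter_upwards [e.open_target.mem_nhds hz, h1] with w hw hw' using ⟨hw, hw'⟩
  have hsm : ∀ w, w ∈ e.target → e.symm w ∈ e'.source →
      ContDiffAt ℂ ω (fun w => e' (e.symm w)) w := fun w hw hw' => by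
    have h1 := contMDiffAt_symm_of_mem_maximalAtlas (I := 𝓘(ℂ, Cn n)) (n := ω)
      (IsManifold.subset_maximalAtlas he) hw
    have h2 := contMDiffAt_of_mem_maximalAtlas (I := 𝓘(ℂ, Cn n)) (n := ω)
      (IsManifold.subset_maximalAtlas he') hw'
    exact (h2.comp w h1).contDiffAt
  refine ⟨(hsm z hz hz').of_le le_top, ?_⟩
  -- The identity is wanted at all nearby `w`, and the chain rule at `w` needs the factorization on
  -- a whole neighbourhood of `w`.
  filter_upwards [hmem.eventually_nhds] with w hev i j
  obtain ⟨hw, hw'⟩ := hev.self_of_nhds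
  have hm : IsManifold 𝓘(ℂ, Cn n) 1 M := IsManifold.of_le (n := ω) le_top
  have hx : e'.symm (e' (e.symm w)) = e.symm w := e'.left_inv hw'
  have hD : chartDeriv e w = (chartDeriv e' (e' (e.symm w))).comp
      (fderiv ℂ (fun w => e' (e.symm w)) w) := by
    have h1 : e.symm =ᶠ[𝓝 w] e'.symm ∘ fun w => e' (e.symm w) := by
      filter_upwards [hev] with v hv using (e'.left_inv hv.2).symm
    have h2 : MDifferentiableAt 𝓘(ℂ, Cn n) 𝓘(ℂ, Cn n) (fun w => e' (e.symm w)) w :=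
      ((hsm w hw hw').differentiableAt (by simp)).mdifferentiableAt
    have h3 : MDifferentiableAt 𝓘(ℂ, Cn n) 𝓘(ℂ, Cn n) e'.symm (e' (e.symm w)) :=
      mdifferentiableAt_atlas_symm he' (e'.map_source hw')
    have h4 := mfderiv_comp w h3 h2
    rw [mfderiv_eq_fderiv] at h4
    exact h1.mfderiv_eq.trans h4
  rw [coeff_eq, hD, ContinuousLinearMap.comp_apply, ContinuousLinearMap.comp_apply, form_sum_sum]
  simp only [coeff_eq, hx]
  rfl

end HermitianMetric

namespace HermitianMetric

/-! ### Almost everywhere and everywhere -/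

/-- A nonnegative integrable function with nonpositive integral vanishes almost everywhere. -/
theorem ae_sub_re_eq_zero {M : Type*} [TopologicalSpace M] [ChartedSpace (Cn n) M]
    [MeasurableSpace M] (h : HermitianMetric n M) (t : ℝ)
    (hS1 : Integrable (h.scalar1 t) h.volume) (hS2 : Integrable (h.scalar2 t) h.volume)
    (hle : (∫ x, h.scalar1 t x ∂h.volume).re ≤ (∫ x, h.scalar2 t x ∂h.volume).re)
    (h0 : ∀ x, 0 ≤ (h.scalar1 t x - h.scalar2 t x).re) :
    ∀ᵐ x ∂h.volume, (h.scalar1 t x - h.scalar2 t x).re = 0 := by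
  have hi : Integrable (fun x => h.scalar1 t x - h.scalar2 t x) h.volume := hS1.sub hS2
  have h1 : ∫ x, (h.scalar1 t x - h.scalar2 t x).re ∂h.volume ≤ 0 := by
    have h2 := integral_re (𝕜 := ℂ) hi
    rw [integral_sub hS1 hS2] at h2
    have h3 : ∫ x, (h.scalar1 t x - h.scalar2 t x).re ∂h.volume =
      ((∫ x, h.scalar1 t x ∂h.volume) - ∫ x, h.scalar2 t x ∂h.volume).re := h2
    rw [h3, Complex.sub_re]
    linarith
  have h4 : ∫ x, (h.scalar1 t x - h.scalar2 t x).re ∂h.volume = 0 :=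
    le_antisymm h1 (integral_nonneg h0)
  exact (integral_eq_zero_iff_of_nonneg_ae (Filter.Eventually.of_forall h0) hi.re).mp h4

variable {M : Type*} [TopologicalSpace M] [ChartedSpace (Cn n) M]
  [IsManifold 𝓘(ℂ, Cn n) ω M] {e : OpenPartialHomeomorph M (Cn n)}

/-- Each chart measure lies below the supremum defining `h.volume`, and its density `2ⁿ det h` is
positive on the chart, so null sets pull back to Lebesgue null sets. -/
theorem ae_chart [MeasurableSpace M] [BorelSpace M] (h : HermitianMetric n M)
    (he : e ∈ atlas (Cn n) M) {p : M → Prop} (hp : ∀ᵐ x ∂h.volume, p x) :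
    ∀ᵐ z ∂(MeasureSpace.volume.restrict e.target), p (e.symm z) := by
  have hH := h.isLocalMetric he
  have hm : MeasurableSet e.target := e.open_target.measurableSet
  have h1 : ∀ᵐ x ∂h.chartVolume e, p x :=
    ae_mono (le_iSup₂ (f := fun e (_ : e ∈ atlas (Cn n) M) => h.chartVolume e) e he) hp
  have hcont : ContinuousOn
      (fun z => ENNReal.ofReal (2 ^ n * (h.coeff e z).det.re)) e.target :=
    ENNReal.continuous_ofReal.comp_continuousOn
      (continuousOn_const.mul (Complex.continuous_re.comp_continuousOn hH.smooth_det.continuousOn))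
  have hsymm : AEMeasurable e.symm ((MeasureSpace.volume.restrict e.target).withDensity
      fun z => ENNReal.ofReal (2 ^ n * (h.coeff e z).det.re)) :=
    (e.continuousOn_symm.aemeasurable hm).mono_ac (withDensity_absolutelyContinuous _ _)
  have h2 := ae_of_ae_map hsymm h1
  rw [ae_withDensity_iff' (hcont.aemeasurable hm)] at h2
  filter_upwards [h2, ae_restrict_mem hm] with z hz hmem
  refine hz ?_
  have hdet := (Complex.lt_def.mp (hH.pos z hmem).det_pos).1
  rw [Complex.zero_re] at hdet
  exact (ENNReal.ofReal_pos.mpr (by positivity)).ne'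

theorem eq_zero_of_ae {U : Set (Cn n)} (hU : IsOpen U) {f : Cn n → ℂ}
    (hf : ContDiffOn ℝ ∞ f U) (h : ∀ᵐ z ∂(MeasureSpace.volume.restrict U), f z = 0) {z : Cn n}
    (hz : z ∈ U) : f z = 0 :=
  Measure.eqOn_open_of_ae_eq (f := f) (g := fun _ => 0) h hU hf.continuousOn continuousOn_const hz

/-- The torsion `T_{ik}^l` at `x` in the preferred chart. -/
def torsionAt (h : HermitianMetric n M) (x : M) : Fin n → Fin n → Fin n → ℂ :=
  chernTorsion (h.coeff (chartAt (Cn n) x)) (chartAt (Cn n) x x)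

/-- The trace `τ_i` of the torsion at `x` in the preferred chart. -/
def torsionTraceAt (h : HermitianMetric n M) (x : M) : Fin n → ℂ :=
  torsionTrace (h.coeff (chartAt (Cn n) x)) (chartAt (Cn n) x x)

/-- `|τ|²`. -/
def torsionTraceNormSqAt (h : HermitianMetric n M) (x : M) : ℂ :=
  torsionTraceNormSq (h.coeff (chartAt (Cn n) x)) (chartAt (Cn n) x x)

/-- `|T|²`. -/
def torsionNormSqAt (h : HermitianMetric n M) (x : M) : ℂ :=
  torsionNormSq (h.coeff (chartAt (Cn n) x)) (chartAt (Cn n) x x)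

theorem isPullbackAt_chartAt (h : HermitianMetric n M) (he : e ∈ atlas (Cn n) M) {z : Cn n}
    (hz : z ∈ e.target) : IsPullbackAt (h.coeff e) (h.coeff (chartAt (Cn n) (e.symm z)))
      (fun w => chartAt (Cn n) (e.symm z) (e.symm w)) z :=
  h.isPullbackAt he (chart_mem_atlas _ _) hz (mem_chart_source _ _)

theorem isLocalMetric_chartAt (h : HermitianMetric n M) (x : M) :
    IsLocalMetric (chartAt (Cn n) x).target (h.coeff (chartAt (Cn n) x)) :=
  h.isLocalMetric (chart_mem_atlas _ _)

theorem isBalanced_iff (h : HermitianMetric n M) (hn : 0 < n) :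
    h.IsBalanced ↔ ∀ e ∈ atlas (Cn n) M, ∀ z ∈ e.target, ∀ i,
      torsionTrace (h.coeff e) z i = 0 := by
  -- Writing `n = m + 1` turns the truncated exponent `n - 1` into `m`, as required by the results
  -- on powers of `ω`.
  obtain ⟨m, rfl⟩ := Nat.exists_eq_add_one.mpr hn
  exact forall₂_congr fun e he => forall₂_congr fun z hz =>
    (h.isLocalMetric he).isClosedAt_fundFormPow_iff hz

theorem scalar1_sub_scalar2 (h : HermitianMetric n M) (hn : 0 < n) (hG : h.IsGauduchon) (t : ℝ)
    (x : M) : h.scalar1 t x - h.scalar2 t x =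
      (t ^ 2 - 4 * t + 1) * h.torsionTraceNormSqAt x + t ^ 2 * h.torsionNormSqAt x := by
  obtain ⟨m, rfl⟩ := Nat.exists_eq_add_one.mpr hn
  have hH := h.isLocalMetric_chartAt x
  exact hH.localScalar1_sub_localScalar2 (mem_chart_target _ _)
    (hH.isGauduchonAt (hG _ (chart_mem_atlas _ _)) (mem_chart_target _ _)) t

theorem scalar1_sub_scalar2_re (h : HermitianMetric n M) (hn : 0 < n) (hG : h.IsGauduchon) (t : ℝ)
    (x : M) : (h.scalar1 t x - h.scalar2 t x).re =
      (t ^ 2 - 4 * t + 1) * (h.torsionTraceNormSqAt x).re + t ^ 2 * (h.torsionNormSqAt x).re := by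
  rw [h.scalar1_sub_scalar2 hn hG]
  have h1 : ((t : ℂ) ^ 2 - 4 * t + 1) = ((t ^ 2 - 4 * t + 1 : ℝ) : ℂ) := by push_cast; rfl
  rw [h1, ← Complex.ofReal_pow, Complex.add_re, Complex.re_ofReal_mul, Complex.re_ofReal_mul]

theorem torsionTraceNormSqAt_nonneg (h : HermitianMetric n M) (x : M) :
    0 ≤ (h.torsionTraceNormSqAt x).re :=
  (h.isLocalMetric_chartAt x).torsionTraceNormSq_nonneg (mem_chart_target _ _)

theorem torsionNormSqAt_nonneg (h : HermitianMetric n M) (x : M) :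
    0 ≤ (h.torsionNormSqAt x).re :=
  (h.isLocalMetric_chartAt x).torsionNormSq_nonneg (mem_chart_target _ _)

theorem IsBalanced.torsionTraceNormSqAt_eq_zero {h : HermitianMetric n M} (hB : h.IsBalanced)
    (hn : 0 < n) (x : M) : h.torsionTraceNormSqAt x = 0 := by
  have h1 := (h.isBalanced_iff hn).mp hB _ (chart_mem_atlas (Cn n) x) _ (mem_chart_target _ x)
  simp [torsionTraceNormSqAt, torsionTraceNormSq, h1]

/-! ### From almost everywhere vanishing to the balanced and Kähler conditions -/

variable [MeasurableSpace M] [BorelSpace M]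

theorem torsionTrace_eq_zero_of_ae (h : HermitianMetric n M)
    (hT : ∀ᵐ x ∂h.volume, ∀ i, h.torsionTraceAt x i = 0) (he : e ∈ atlas (Cn n) M) {z : Cn n}
    (hz : z ∈ e.target) (i : Fin n) : torsionTrace (h.coeff e) z i = 0 := by
  refine eq_zero_of_ae e.open_target ((h.isLocalMetric he).smooth_torsionTrace i) ?_ hz
  filter_upwards [h.ae_chart he hT, ae_restrict_mem e.open_target.measurableSet] with w hw hmem
  rw [(h.isPullbackAt_chartAt he hmem).torsionTrace_eq (h.isLocalMetric he) hmem
    (h.isLocalMetric_chartAt _) (mem_chart_target _ _)]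
  exact Finset.sum_eq_zero fun a _ => mul_eq_zero_of_right _ (hw a)

/-- At almost every point of the fixed chart, vanishing is transported from the preferred chart;
smoothness in the fixed chart then removes the exceptional set. -/
theorem chernTorsion_eq_zero_of_ae (h : HermitianMetric n M)
    (hT : ∀ᵐ x ∂h.volume, ∀ i k l, h.torsionAt x i k l = 0) (he : e ∈ atlas (Cn n) M) {z : Cn n}
    (hz : z ∈ e.target) (i k l : Fin n) : chernTorsion (h.coeff e) z i k l = 0 := by
  refine eq_zero_of_ae e.open_target ((h.isLocalMetric he).smooth_chernTorsion i k l) ?_ hz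
  filter_upwards [h.ae_chart he hT, ae_restrict_mem e.open_target.measurableSet] with w hw hmem
  exact (h.isPullbackAt_chartAt he hmem).chernTorsion_eq_zero (h.isLocalMetric he) hmem
    (h.isLocalMetric_chartAt _) (mem_chart_target _ _) hw i k l

theorem isKahler_of_ae (h : HermitianMetric n M)
    (hT : ∀ᵐ x ∂h.volume, ∀ i k l, h.torsionAt x i k l = 0) : h.IsKahler := fun _ he _ hz =>
  (h.isLocalMetric he).isClosedAt_fundForm hz (h.chernTorsion_eq_zero_of_ae hT he hz)

theorem isKahler_of_torsionNormSqAt (h : HermitianMetric n M)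
    (hT : ∀ᵐ x ∂h.volume, (h.torsionNormSqAt x).re = 0) : h.IsKahler :=
  h.isKahler_of_ae (hT.mono fun x hx =>
    (h.isLocalMetric_chartAt x).chernTorsion_eq_zero (mem_chart_target _ _) hx)

theorem isBalanced_of_torsionTraceNormSqAt (h : HermitianMetric n M) (hn : 0 < n)
    (hT : ∀ᵐ x ∂h.volume, (h.torsionTraceNormSqAt x).re = 0) : h.IsBalanced :=
  (h.isBalanced_iff hn).mpr fun _ he _ hz => h.torsionTrace_eq_zero_of_ae (hT.mono fun x hx =>
    (h.isLocalMetric_chartAt x).torsionTrace_eq_zero (mem_chart_target _ _) hx) he hz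

end HermitianMetric

end HermGeom

end

/-! ### The four cases -/

theorem mainTheorem10 {n : ℕ} {M : Type*} [TopologicalSpace M] [T2Space M]
    [SecondCountableTopology M] [ChartedSpace (HermGeom.Cn n) M]
    [IsManifold 𝓘(ℂ, HermGeom.Cn n) ω M] [MeasurableSpace M] [BorelSpace M]
    (h : HermGeom.HermitianMetric n M) (hcomplete : h.IsComplete) (hGauduchon : h.IsGauduchon)
    (t : ℝ)
    (hS1 : Integrable (h.scalar1 t) h.volume) (hS2 : Integrable (h.scalar2 t) h.volume)
    (hle : (∫ x, h.scalar1 t x ∂h.volume).re ≤ (∫ x, h.scalar2 t x ∂h.volume).re) :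
    (3 ≤ n → t = 0 → h.IsBalanced ∧ h.scalar1 t = h.scalar2 t) ∧
    (3 ≤ n → t ≠ 0 → h.IsBalanced → h.IsKahler) ∧
    (2 ≤ n → t ∈ Set.Iio 0 ∪ Set.Ioc 0 (2 - Real.sqrt 3) ∪ Set.Ici (2 + Real.sqrt 3) →
      h.IsKahler) ∧
    (n = 2 → t ∈ Set.Iio (1 / 3) ∪ Set.Ioi 1 → h.IsKahler) := by
  have hre := fun hn : 0 < n => h.scalar1_sub_scalar2_re hn hGauduchon t
  have hτ := h.torsionTraceNormSqAt_nonneg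
  have hT := h.torsionNormSqAt_nonneg
  have hae := h.ae_sub_re_eq_zero t hS1 hS2 hle
  refine ⟨fun hn ht => ?_, fun hn ht hB => ?_, fun hn ht => ?_, fun hn ht => ?_⟩
  · have hn0 : 0 < n := by omega
    have h1 : ∀ x, (h.scalar1 t x - h.scalar2 t x).re = (h.torsionTraceNormSqAt x).re := fun x => by
      rw [hre hn0, ht]
      ring
    simp only [h1] at hae
    have hB := h.isBalanced_of_torsionTraceNormSqAt hn0 (hae hτ)
    -- Once the metric is balanced, `|τ|²` vanishes at every point, and the pointwise identity at `t
    -- = 0` gives equality of the complex-valued scalar curvatures everywhere.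
    refine ⟨hB, funext fun x => sub_eq_zero.mp ?_⟩
    rw [h.scalar1_sub_scalar2 hn0 hGauduchon, hB.torsionTraceNormSqAt_eq_zero hn0, ht]
    simp
  · have hn0 : 0 < n := by omega
    have ht2 : 0 < t ^ 2 := by positivity
    have h1 : ∀ x, (h.scalar1 t x - h.scalar2 t x).re = t ^ 2 * (h.torsionNormSqAt x).re :=
      fun x => by
        rw [hre hn0, hB.torsionTraceNormSqAt_eq_zero hn0]
        simp
    simp only [h1] at hae
    exact h.isKahler_of_torsionNormSqAt ((hae fun x => mul_nonneg ht2.le (hT x)).mono fun x hx =>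
      (mul_eq_zero.mp hx).resolve_left ht2.ne')
  · have hn0 : 0 < n := by omega
    have h3 : Real.sqrt 3 ^ 2 = 3 := Real.sq_sqrt (by norm_num)
    have h3' : 0 ≤ Real.sqrt 3 := Real.sqrt_nonneg 3
    -- The roots are `2 ± √3`, since `t² - 4t + 1 = (t - 2)² - 3`. At the roots the `|τ|²` term is
    -- lost, but `t ≠ 0` keeps `t²|T|²`, which alone controls the torsion.
    have ht0 : t ≠ 0 ∧ 0 ≤ t ^ 2 - 4 * t + 1 := by
      rcases ht with (ht | ht) | ht
      · have ht : t < 0 := ht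
        exact ⟨ht.ne, by nlinarith⟩
      · have h4 := pow_le_pow_left₀ h3' (by linarith [ht.2] : Real.sqrt 3 ≤ 2 - t) 2
        exact ⟨ht.1.ne', by linarith⟩
      · have ht : 2 + Real.sqrt 3 ≤ t := ht
        have h4 := pow_le_pow_left₀ h3' (by linarith : Real.sqrt 3 ≤ t - 2) 2
        exact ⟨by linarith, by linarith⟩
    have ht2 : 0 < t ^ 2 := by
      have := ht0.1
      positivity
    have h1 := hae fun x => by
      rw [hre hn0]
      exact add_nonneg (mul_nonneg ht0.2 (hτ x)) (mul_nonneg ht2.le (hT x))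
    refine h.isKahler_of_torsionNormSqAt (h1.mono fun x hx => ?_)
    rw [hre hn0] at hx
    have h2 := mul_nonneg ht0.2 (hτ x)
    have h4 := mul_nonneg ht2.le (hT x)
    exact (mul_eq_zero.mp (le_antisymm (by linarith) h4)).resolve_left ht2.ne'
  · subst hn
    have h2 : ∀ x, h.torsionNormSqAt x = 2 * h.torsionTraceNormSqAt x := fun x =>
      (h.isLocalMetric_chartAt x).torsionNormSq_eq_two_mul (mem_chart_target _ _)
    -- The polynomial is `(3t - 1)(t - 1)`, obtained by substituting `|T|² = 2|τ|²`; strict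
    -- positivity makes `|τ|²`, and hence `|T|²`, vanish almost everywhere.
    have ht0 : 0 < 3 * t ^ 2 - 4 * t + 1 := by
      rcases ht with ht | ht
      · have ht : t < 1 / 3 := ht
        nlinarith
      · have ht : 1 < t := ht
        nlinarith
    have h1 : ∀ x, (h.scalar1 t x - h.scalar2 t x).re =
        (3 * t ^ 2 - 4 * t + 1) * (h.torsionTraceNormSqAt x).re := fun x => by
      rw [hre (by norm_num), h2]
      simp only [Complex.mul_re, Complex.re_ofNat, Complex.im_ofNat]
      ring
    simp only [h1] at hae
    refine h.isKahler_of_torsionNormSqAt ((hae fun x => mul_nonneg ht0.le (hτ x)).mono fun x hx => ?_)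
    rw [h2]
    simp [(mul_eq_zero.mp hx).resolve_left ht0.ne']
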